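/- Let $Q(v)=vBv^{T}$, $v=(x,y,z)\in\mathbb{C}^3$ a row vector, be a nondegenerate complex quadratic form with symmetric invertible matrix $B$, and let $\Delta_Q=\sum_{j,k}b^{jk}\partial_j\partial_k$, where $(b^{jk})=B^{-1}$. Let $V(d)$ be the space of homogeneous polynomials of degree $d$ in $\mathbb{C}[x,y,z]$, let $V_Q(d)\subset V(d)$ be the subspace of polynomials divisible by $Q$, and let $Har_Q(d)=V(d)\cap\ker\Delta_Q$. Let $O_Q(3;\mathbb{C})$ be the group of all $U\in GL(3;\mathbb{C})$ with $Q(vU)=Q(v)$ for all $v$, acting on polynomials by $P(v)\mapsto P(vU)$. (1) For every $d\ge 0$, $$V(d)=\bigoplus_{0\le 2k\le d}Q^k\cdot Har_Q(d-2k),$$ and each summand is invariant under $O_Q(3;\mathbb{C})$. There are invertible complex matrices $A$ with $Q(v)=\sum_{i}((vA)_i)^2$ for all $v$. For every such $A$, let $\Upsilon_Q=\{v\in\mathbb{C}^3: Q(v)=1,\ vA\in\mathbb{R}^3\}$, which is the image of the unit sphere $S^2\subset\mathbb{R}^3$ under $A^{-1}$, and let $dm_Q$ be the standard surface measure of $S^2$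 transported to $\Upsilon_Q$ by $A^{-1}$. Then $\langle P,T\rangle=\int_{\Upsilon_Q}P\cdot\overline{T}\,dm_Q$ is a Hermitian inner product on each $V(d)$; the summands above are pairwise orthogonal for it; and a polynomial $P\in V(d)$ lies in $Har_Q(d)$ if and only if $\int_{\Upsilon_Q}P\cdot\overline{T}\,dm_Q=0$ for every $T\in V_Q(d)$. (2) For every $c\in\mathbb{C}$, every polynomial function on the surface $\mathcal{S}=\{Q=c\}\subset\mathbb{C}^3$ is the restriction to $\mathcal{S}$ of a polynomial $P$ (not necessarily homogeneous) with $\Delta_Q(P)=0$. (3) For every $c\in\mathbb{C}$, with $\mathcal{S}=\{Q=c\}$, and all polynomials $M,N\in\mathbb{C}[x,y,z]$, the Dirichlet problem $\Delta_Q(P)=M$, $P|_{\mathcal{S}}=N|_{\mathcal{S}}$ has a unique polynomial solution $P$. (4) For every $P\in V(d)$ there are vectors $\mathbf{u}_{j,k}\in\mathbb{C}^3$ ($0\le 2k\le d$, $1\le j\le d-2k$) and a scalar $a\in\mathbb{C}$ such that $$P=\sum_{0\le 2k\le d}a_k\,Q^{d-k+\frac12}\cdot\nabla_{\mathbf{u}_{1,k}}\nabla_{\mathbf{u}_{2,k}}\cdots\nabla_{\mathbf{u}_{d-2k,k}}\left(Q^{-\frac12}\right),$$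 where $a_k=1$ if $2k<d$ and $a_k=a$ if $2k=d$, and $\nabla_{\mathbf{u}}$ is the directional derivative. The identity holds on every open set of $\mathbb{C}^3$ on which $Q$ has no zeros and $Q^{1/2}$ has a holomorphic branch, for every such branch, with the same $\mathbf{u}_{j,k}$ and $a$. -/

import Mathlib

open MvPolynomial MeasureTheory
open scoped Matrix ComplexConjugate

namespace QHarmonic

/-- Points of `ℂ³`, regarded as row vectors `(x, y, z)`; matrices act on the right. -/
abbrev C3 : Type := Fin 3 → ℂ

/-- The ring `ℂ[x, y, z]`. -/
abbrev Poly : Type := MvPolynomial (Fin 3) ℂ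

/-- The space `V(d)` of homogeneous polynomials of degree `d` (including `0`). -/
noncomputable abbrev V (d : ℕ) : Submodule ℂ Poly := homogeneousSubmodule (Fin 3) ℂ d

/-- The quadratic form `Q(v) = v B vᵀ` as a polynomial, where `B = Q.toMatrix'` is its
symmetric matrix. -/
noncomputable def formPoly (Q : QuadraticForm ℂ C3) : Poly :=
  ∑ i, ∑ j, C (Q.toMatrix' i j) * X i * X j

/-- The operator `Δ_Q = ∑ b^{jk} ∂_j ∂_k`, where `(b^{jk}) = B⁻¹`. -/
noncomputable def laplacian (Q : QuadraticForm ℂ C3) : Poly →ₗ[ℂ] Poly :=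
  ∑ j, ∑ k, (Q.toMatrix')⁻¹ j k • ((pderiv j).toLinearMap ∘ₗ (pderiv k).toLinearMap)

/-- `Har_Q(d)`: the homogeneous polynomials `P` of degree `d` with `Δ_Q P = 0`. -/
noncomputable def Har (Q : QuadraticForm ℂ C3) (d : ℕ) : Submodule ℂ Poly :=
  V d ⊓ LinearMap.ker (laplacian Q)

/-- `V_Q(d)`: the homogeneous polynomials of degree `d` divisible by `Q`. -/
noncomputable def VQ (Q : QuadraticForm ℂ C3) (d : ℕ) : Submodule ℂ Poly :=
  V d ⊓ (Ideal.span {formPoly Q}).restrictScalars ℂ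

/-- `Q^k · Har_Q(d - 2k)`; used only for `2 * k ≤ d`. -/
noncomputable def summand (Q : QuadraticForm ℂ C3) (d k : ℕ) : Submodule ℂ Poly :=
  (Har Q (d - 2 * k)).map (LinearMap.mulLeft ℂ (formPoly Q ^ k))

/-- The surface `{Q = c}` in `ℂ³`. -/
def surface (Q : QuadraticForm ℂ C3) (c : ℂ) : Set C3 := {v | Q v = c}

/-- The group `O_Q(3; ℂ)` of invertible matrices `U` with `Q(vU) = Q(v)`. -/
def orthogonalGroup (Q : QuadraticForm ℂ C3) : Subgroup (GL (Fin 3) ℂ) where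
  carrier := {U | ∀ v : C3, Q (v ᵥ* U.val) = Q v}
  one_mem' := by intro v; simp
  mul_mem' := by
    intro U W hU hW v
    rw [Units.val_mul, ← Matrix.vecMul_vecMul, hW, hU]
  inv_mem' := by
    intro U hU v
    have h := hU (v ᵥ* (U⁻¹).val)
    rw [Matrix.vecMul_vecMul, ← Units.val_mul, inv_mul_cancel, Units.val_one,
      Matrix.vecMul_one] at h
    exact h.symm

/-- The action `P ↦ P((x, y, z) · U)` of matrices on polynomials. -/
noncomputable def substMatrix (U : GL (Fin 3) ℂ) : Poly →ₐ[ℂ] Poly :=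
  aeval fun j => ∑ i, C (U.val i j) * X i

/-- The coordinate change `v' = vA` reduces `Q` to the sum of squares. -/
def ReducesToSquares (Q : QuadraticForm ℂ C3) (A : GL (Fin 3) ℂ) : Prop :=
  ∀ v : C3, Q v = ∑ i, ((v ᵥ* A.val) i) ^ 2

/-- The totally real ellipsoid `Υ_Q`: the points `v` of `{Q = 1}` for which `vA` is real. -/
def ellipsoid (Q : QuadraticForm ℂ C3) (A : GL (Fin 3) ℂ) : Set C3 :=
  {v | v ∈ surface Q 1 ∧ ∀ i, ((v ᵥ* A.val) i).im = 0}

/-- The measure `dm_Q`: the standard surface measure of the unit sphere in `ℝ³`, transported by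
`x' ↦ x' A⁻¹`. It is regarded as a measure on `ℂ³`. -/
noncomputable def ellipsoidMeasure (A : GL (Fin 3) ℂ) : Measure C3 :=
  (volume : Measure (EuclideanSpace ℝ (Fin 3))).toSphere.map
    fun x => (fun i => ((x.val i : ℝ) : ℂ)) ᵥ* (A⁻¹).val

/-- The Hermitian product `∫_{Υ_Q} P · conj T dm_Q`. -/
noncomputable def herm (Q : QuadraticForm ℂ C3) (A : GL (Fin 3) ℂ) (P T : Poly) : ℂ :=
  ∫ v in ellipsoid Q A, eval v P * conj (eval v T) ∂(ellipsoidMeasure A)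

/-- `∇_{u₁} ∇_{u₂} ⋯ ∇_{uₙ} f`, iterated complex directional derivatives. -/
noncomputable def iterDirDeriv : List C3 → (C3 → ℂ) → C3 → ℂ
  | [], f => f
  | u :: us, f => fun v => lineDeriv ℂ (iterDirDeriv us f) v u

/-- `r` is a holomorphic branch of `Q^{1/2}` on the open set `Ω`, on which `Q` has no zeros. -/
structure IsSqrtBranch (Q : QuadraticForm ℂ C3) (Ω : Set C3) (r : C3 → ℂ) : Prop where
  isOpen : IsOpen Ω
  ne_zero : ∀ v ∈ Ω, Q v ≠ 0
  holomorphic : DifferentiableOn ℂ r Ω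
  sq_eq : ∀ v ∈ Ω, r v ^ 2 = Q v

end QHarmonic

/-
Since `Δ_Q (Q P) = Q Δ_Q P + (4 d + 6) P` for `P` of degree `d`, the operator `P ↦ Δ_Q (Q P)` is
invertible on `V(d)`, which splits `V(d + 2)` as `Har_Q(d + 2) ⊕ Q V(d)`; the same relation makes
the `Q ^ k Har_Q(d - 2 k)` eigenspaces of `Q Δ_Q` with distinct eigenvalues. Perturbing by a scalar,
`P ↦ Δ_Q ((Q - c) P)` is bijective on `ℂ[x, y, z]`. As `Q - c` is squarefree, the polynomials
vanishing on `{Q = c}` are its multiples, and bijectivity is precisely the unique solvability of the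
Dirichlet problem.

Orthogonality is checked on the round sphere. A Gaussian integral of a homogeneous polynomial is a
positive multiple of its integral over the sphere, and under a Gaussian weight `∂_i` and
multiplication by `x_i` have the same integral, so Green's identity for two harmonic polynomials
of different degrees is an algebraic computation.

For the Maxwell representation, `n` derivatives of `Q ^ (-1/2)` equal `M * Q ^ (-1/2 - n)` with `M`
harmonic of degree `n` and congruent, modulo `Q` and a nonzero factor, to the product of the linear
forms `B u_j`. Conversely, on the conic `Q = 0`, parametrized by quadratic polynomials in one
variable, a harmonic form of degree `n` becomes a polynomial of degree at most `2 n`, which splits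
into `n` factors of degree at most two, that is, into linear forms on the conic. A harmonic
polynomial divisible by `Q` vanishes, so the two harmonic polynomials coincide.
-/

namespace QHarmonic

section FischerPair

theorem homogeneousComponent_mul_of_isHomogeneous {σ R : Type*} [CommSemiring R]
    {F : MvPolynomial σ R} {n : ℕ} (hF : F.IsHomogeneous n) (m : ℕ) (S : MvPolynomial σ R) :
    homogeneousComponent (n + m) (F * S) = F * homogeneousComponent m S := by
  let _ := gradedAlgebra (σ := σ) (R := R)
  simp only [← decomposition.decompose'_apply]
  exact DirectSum.coe_decompose_mul_add_of_left_mem (homogeneousSubmodule σ R) hF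

theorem eq_zero_of_forall_homogeneousComponent_eq_zero {σ R : Type*} [CommSemiring R]
    {P : MvPolynomial σ R} (h : ∀ d, homogeneousComponent d P = 0) : P = 0 := by
  rw [← sum_homogeneousComponent P]
  exact Finset.sum_eq_zero fun d _ => h d

variable {σ R : Type*} [CommRing R]

/-- A quadratic form `q` and an operator `L` lowering degrees by two, such that `[L, q]` acts on
forms of degree `d` as the positive scalar `4 * d + n`. For a nondegenerate quadratic form and its
dual Laplacian, `n` is twice the number of variables. -/
structure IsFischerPair (q : MvPolynomial σ R) (L : MvPolynomial σ R →ₗ[R] MvPolynomial σ R)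
    (n : ℕ) : Prop where
  pos : 0 < n
  isHomogeneous : q.IsHomogeneous 2
  map_isHomogeneous : ∀ {d P}, P.IsHomogeneous (d + 2) → (L P).IsHomogeneous d
  map_eq_zero : ∀ {d P}, P.IsHomogeneous d → d < 2 → L P = 0
  map_mul : ∀ {d P}, P.IsHomogeneous d → L (q * P) = q * L P + ((4 * d + n : ℕ) : R) • P

/-- The forms of degree `d` annihilated by `L`. -/
noncomputable def harmonic (L : MvPolynomial σ R →ₗ[R] MvPolynomial σ R) (d : ℕ) :
    Submodule R (MvPolynomial σ R) :=
  homogeneousSubmodule σ R d ⊓ LinearMap.ker L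

/-- The `k`-th term `q ^ k * harmonic L (d - 2 * k)` of the Fischer decomposition of the forms of
degree `d`; meaningful only for `2 * k ≤ d`. -/
noncomputable def fischerSummand (q : MvPolynomial σ R)
    (L : MvPolynomial σ R →ₗ[R] MvPolynomial σ R) (d k : ℕ) : Submodule R (MvPolynomial σ R) :=
  (harmonic L (d - 2 * k)).map (LinearMap.mulLeft R (q ^ k))

namespace IsFischerPair

section CommRing

variable {q : MvPolynomial σ R} {L : MvPolynomial σ R →ₗ[R] MvPolynomial σ R} {n : ℕ}

theorem mul_isHomogeneous (h : IsFischerPair q L n) {d : ℕ} {P : MvPolynomial σ R}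
    (hP : P.IsHomogeneous d) : (q * P).IsHomogeneous (d + 2) :=
  add_comm 2 d ▸ h.isHomogeneous.mul hP

theorem homogeneousComponent_mul (h : IsFischerPair q L n) (d : ℕ) (P : MvPolynomial σ R) :
    homogeneousComponent (d + 2) (q * P) = q * homogeneousComponent d P :=
  add_comm 2 d ▸ homogeneousComponent_mul_of_isHomogeneous h.isHomogeneous d P

theorem homogeneousComponent_map (h : IsFischerPair q L n) (d : ℕ) (P : MvPolynomial σ R) :
    homogeneousComponent d (L P) = L (homogeneousComponent (d + 2) P) := by
  conv_lhs => rw [← sum_homogeneousComponent P, map_sum, map_sum]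
  conv_rhs => rw [← sum_homogeneousComponent P, map_sum, map_sum]
  refine Finset.sum_congr rfl fun e _ => ?_
  have he := homogeneousComponent_isHomogeneous e P
  rw [homogeneousComponent_of_mem (m := d + 2) he]
  obtain hlt | ⟨e, rfl⟩ := (lt_or_ge e 2).imp_right Nat.exists_eq_add_of_le'
  · rw [h.map_eq_zero he hlt, if_neg (by omega), map_zero, map_zero]
  · rw [homogeneousComponent_of_mem (h.map_isHomogeneous he)]
    split_ifs <;> first | rfl | omega | rw [map_zero]

theorem fischerSummand_le (h : IsFischerPair q L n) {d k : ℕ} (hk : 2 * k ≤ d) :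
    fischerSummand q L d k ≤ homogeneousSubmodule σ R d := by
  rintro _ ⟨H, hH, rfl⟩
  have := (h.isHomogeneous.pow k).mul hH.1
  rwa [Nat.add_sub_cancel' hk] at this

theorem map_pow_mul_harmonic (h : IsFischerPair q L n) {e : ℕ} {H : MvPolynomial σ R}
    (hH : H ∈ harmonic L e) (k : ℕ) :
    L (q ^ (k + 1) * H) = (((k + 1) * (4 * e + 4 * k + n) : ℕ) : R) • (q ^ k * H) := by
  induction k with
  | zero => simp [h.map_mul hH.1, LinearMap.mem_ker.1 hH.2]
  | succ k ih =>
    rw [pow_succ', mul_assoc, h.map_mul ((h.isHomogeneous.pow (k + 1)).mul hH.1), ih,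
      mul_smul_comm, ← mul_assoc, ← pow_succ', ← add_smul, ← Nat.cast_add]
    congr 2
    ring

theorem fischerSummand_le_eigenspace (h : IsFischerPair q L n) {d k : ℕ} (hk : 2 * k ≤ d) :
    fischerSummand q L d k ≤ Module.End.eigenspace (LinearMap.mulLeft R q ∘ₗ L)
      ((k : R) * (4 * d + n - 4 - 4 * k)) := by
  rintro _ ⟨H, hH, rfl⟩
  rw [Module.End.mem_eigenspace_iff, LinearMap.comp_apply, LinearMap.mulLeft_apply,
    LinearMap.mulLeft_apply]
  cases k with
  | zero =>
    have hLH : L H = 0 := hH.2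
    simp [hLH]
  | succ k =>
    rw [h.map_pow_mul_harmonic hH, mul_smul_comm, ← mul_assoc, ← pow_succ']
    congr 1
    push_cast [Nat.cast_sub hk]
    ring

end CommRing

section Field

variable {σ K : Type*} [Field K] [CharZero K] {q : MvPolynomial σ K}
  {L : MvPolynomial σ K →ₗ[K] MvPolynomial σ K} {n : ℕ}

theorem eq_zero_of_mul_map_add (h : IsFischerPair q L n) {d : ℕ} {P : MvPolynomial σ K}
    (hP : P.IsHomogeneous d) {a : ℕ} (ha : 0 < a) (hPa : q * L P + (a : K) • P = 0) : P = 0 := by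
  induction d using Nat.strong_induction_on generalizing P a with
  | _ d ih =>
    have hLP : L P = 0 := by
      obtain hlt | ⟨d, rfl⟩ := (lt_or_ge d 2).imp_right Nat.exists_eq_add_of_le'
      · exact h.map_eq_zero hP hlt
      · have hLPd := h.map_isHomogeneous hP
        refine ih d (by omega) hLPd (a := 4 * d + n + a) (by omega) ?_
        have := congrArg L hPa
        rwa [map_add, map_smul, map_zero, h.map_mul hLPd, add_assoc, ← add_smul,
          ← Nat.cast_add] at this
    rw [hLP, mul_zero, zero_add] at hPa
    exact (smul_eq_zero.1 hPa).resolve_left (Nat.cast_ne_zero.2 ha.ne')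

theorem exists_mul_map_add (h : IsFischerPair q L n) {d : ℕ} {F : MvPolynomial σ K}
    (hF : F.IsHomogeneous d) {a : ℕ} (ha : 0 < a) :
    ∃ P : MvPolynomial σ K, P.IsHomogeneous d ∧ q * L P + (a : K) • P = F := by
  induction d using Nat.strong_induction_on generalizing F a with
  | _ d ih =>
    have ha' : (a : K) ≠ 0 := Nat.cast_ne_zero.2 ha.ne'
    obtain hlt | ⟨d, rfl⟩ := (lt_or_ge d 2).imp_right Nat.exists_eq_add_of_le'
    · have hP : ((a : K)⁻¹ • F).IsHomogeneous d := (homogeneousSubmodule σ K d).smul_mem _ hF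
      exact ⟨_, hP, by rw [h.map_eq_zero hP hlt, mul_zero, zero_add, smul_inv_smul₀ ha']⟩
    · -- The sought `P` determines `R = L P`, which solves an equation of the same kind.
      obtain ⟨R, hR, hRF⟩ := ih d (by omega) (h.map_isHomogeneous hF) (a := 4 * d + n + a)
        (by omega)
      have hLR : L ((a : K)⁻¹ • (F - q * R)) = R := by
        rw [map_smul, map_sub, h.map_mul hR, ← hRF, Nat.cast_add, add_smul, ← add_assoc,
          add_sub_cancel_left, inv_smul_smul₀ ha']
      refine ⟨(a : K)⁻¹ • (F - q * R), (homogeneousSubmodule σ K _).smul_mem _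
        (hF.sub (h.mul_isHomogeneous hR)), ?_⟩
      rw [hLR, smul_inv_smul₀ ha', add_sub_cancel]

theorem eq_zero_of_map_mul (h : IsFischerPair q L n) {d : ℕ} {P : MvPolynomial σ K}
    (hP : P.IsHomogeneous d) (hqP : L (q * P) = 0) : P = 0 :=
  h.eq_zero_of_mul_map_add hP (Nat.add_pos_right _ h.pos) (h.map_mul hP ▸ hqP)

theorem exists_map_mul (h : IsFischerPair q L n) {d : ℕ} {F : MvPolynomial σ K}
    (hF : F.IsHomogeneous d) : ∃ P : MvPolynomial σ K, P.IsHomogeneous d ∧ L (q * P) = F := by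
  obtain ⟨P, hP, hPF⟩ := h.exists_mul_map_add hF (Nat.add_pos_right (4 * d) h.pos)
  exact ⟨P, hP, (h.map_mul hP).trans hPF⟩

theorem injective_map_sub_C_mul (h : IsFischerPair q L n) (c : K) :
    Function.Injective (L ∘ₗ LinearMap.mulLeft K (q - C c)) := by
  refine (injective_iff_map_eq_zero _).2 fun R hR => ?_
  have hcomponent (d : ℕ) :
      L (q * homogeneousComponent d R) = c • L (homogeneousComponent (d + 2) R) := by
    have hLR : L (q * R) = c • L R := by
      rwa [LinearMap.comp_apply, LinearMap.mulLeft_apply, sub_mul, C_mul', map_sub, map_smul,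
        sub_eq_zero] at hR
    rw [← h.homogeneousComponent_mul, ← h.homogeneousComponent_map, hLR, map_smul,
      h.homogeneousComponent_map]
  have hvanish (k d : ℕ) (hd : R.totalDegree < d + 2 * k) : homogeneousComponent d R = 0 := by
    induction k generalizing d with
    | zero => exact homogeneousComponent_eq_zero _ _ hd
    | succ k ih =>
      refine h.eq_zero_of_map_mul (homogeneousComponent_isHomogeneous d R) ?_
      rw [hcomponent, ih (d + 2) (by omega), map_zero, smul_zero]
  exact eq_zero_of_forall_homogeneousComponent_eq_zero fun d =>
    hvanish (R.totalDegree + 1) d (by omega)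

theorem surjective_map_sub_C_mul (h : IsFischerPair q L n) (c : K) :
    Function.Surjective (L ∘ₗ LinearMap.mulLeft K (q - C c)) := by
  set D := L ∘ₗ LinearMap.mulLeft K (q - C c) with hD
  have homogeneous_mem_range (d : ℕ) (F : MvPolynomial σ K) (hF : F.IsHomogeneous d) :
      F ∈ LinearMap.range D := by
    induction d using Nat.strong_induction_on generalizing F with
    | _ d ih =>
      obtain ⟨R, hR, rfl⟩ := h.exists_map_mul hF
      have hLR : L R ∈ LinearMap.range D := by
        obtain hlt | ⟨d, rfl⟩ := (lt_or_ge d 2).imp_right Nat.exists_eq_add_of_le'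
        · rw [h.map_eq_zero hR hlt]
          exact zero_mem _
        · exact ih d (by omega) _ (h.map_isHomogeneous hR)
      have hDR : L (q * R) = D R + c • L R := by
        rw [hD, LinearMap.comp_apply, LinearMap.mulLeft_apply, sub_mul, C_mul', map_sub, map_smul,
          sub_add_cancel]
      rw [hDR]
      exact add_mem ⟨R, rfl⟩ (Submodule.smul_mem _ c hLR)
  intro F
  rw [← LinearMap.mem_range, ← sum_homogeneousComponent F]
  exact sum_mem fun d _ => homogeneous_mem_range d _ (homogeneousComponent_isHomogeneous d F)

theorem bijective_map_sub_C_mul (h : IsFischerPair q L n) (c : K) :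
    Function.Bijective (L ∘ₗ LinearMap.mulLeft K (q - C c)) :=
  ⟨h.injective_map_sub_C_mul c, h.surjective_map_sub_C_mul c⟩

theorem eq_zero_of_dvd (h : IsFischerPair q L n) {P : MvPolynomial σ K} (hP : L P = 0)
    (hqP : q ∣ P) : P = 0 := by
  obtain ⟨R, rfl⟩ := hqP
  have hR : R = 0 := h.injective_map_sub_C_mul 0 (by simpa using hP)
  rw [hR, mul_zero]

theorem exists_harmonic_add_mul (h : IsFischerPair q L n) {d : ℕ} {P : MvPolynomial σ K}
    (hP : P.IsHomogeneous (d + 2)) :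
    ∃ H ∈ harmonic L (d + 2), ∃ R : MvPolynomial σ K, R.IsHomogeneous d ∧ P = H + q * R := by
  obtain ⟨R, hR, hRP⟩ := h.exists_map_mul (h.map_isHomogeneous hP)
  refine ⟨P - q * R, ⟨hP.sub (h.mul_isHomogeneous hR), ?_⟩, R, hR, (sub_add_cancel P _).symm⟩
  exact (map_sub L P _).trans (sub_eq_zero.2 hRP.symm)

theorem exists_eq_sum_pow_mul (h : IsFischerPair q L n) {d : ℕ} {P : MvPolynomial σ K}
    (hP : P.IsHomogeneous d) :
    ∃ H : ℕ → MvPolynomial σ K, (∀ k, H k ∈ harmonic L (d - 2 * k)) ∧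
      P = ∑ k ∈ Finset.range (d / 2 + 1), q ^ k * H k := by
  induction d using Nat.strong_induction_on generalizing P with
  | _ d ih =>
    obtain hlt | ⟨d, rfl⟩ := (lt_or_ge d 2).imp_right Nat.exists_eq_add_of_le'
    · have hmem : P ∈ harmonic L (d - 2 * 0) := ⟨hP, h.map_eq_zero hP hlt⟩
      refine ⟨fun k => k.casesOn P 0, fun k => ?_, by simp [Nat.div_eq_of_lt hlt]⟩
      cases k with
      | zero => exact hmem
      | succ => exact zero_mem _
    · obtain ⟨H₀, hH₀, R, hR, rfl⟩ := h.exists_harmonic_add_mul hP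
      obtain ⟨H, hH, rfl⟩ := ih d (by omega) hR
      refine ⟨fun k => k.casesOn H₀ H, fun k => ?_, ?_⟩
      · cases k with
        | zero => exact hH₀
        | succ k => simpa only [mul_add_one, Nat.add_sub_add_right] using hH k
      · rw [Nat.add_div_right d two_pos, Finset.sum_range_succ' _ (d / 2 + 1), Finset.mul_sum,
          pow_zero, one_mul, add_comm]
        simp only [pow_succ', mul_assoc]
        rfl

theorem iSup_fischerSummand (h : IsFischerPair q L n) (d : ℕ) :
    ⨆ k : Fin (d / 2 + 1), fischerSummand q L d k = homogeneousSubmodule σ K d := by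
  refine le_antisymm (iSup_le fun k => h.fischerSummand_le (by omega)) fun P hP => ?_
  obtain ⟨H, hH, rfl⟩ := h.exists_eq_sum_pow_mul hP
  exact sum_mem fun k hk => Submodule.mem_iSup_of_mem
    (p := fun k : Fin (d / 2 + 1) => fischerSummand q L d k) ⟨k, Finset.mem_range.1 hk⟩
    ⟨H k, hH k, rfl⟩

theorem iSupIndep_fischerSummand (h : IsFischerPair q L n) (d : ℕ) :
    iSupIndep fun k : Fin (d / 2 + 1) => fischerSummand q L d k := by
  have eigenvalue_injective : Function.Injective
      fun k : Fin (d / 2 + 1) => ((k : ℕ) : K) * (4 * d + n - 4 - 4 * k) := by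
    intro k l hkl
    by_contra hne
    have hlt : 4 * (k + l : ℕ) + 4 < 4 * d + n := by
      have := h.pos
      omega
    have hne' : ((k : ℕ) : K) - (l : ℕ) ≠ 0 := by
      rw [sub_ne_zero, Ne, Nat.cast_inj]
      exact fun hkl' => hne (Fin.ext hkl')
    have hfactor : (((k : ℕ) : K) - (l : ℕ)) * (4 * d + n - (4 * (k + l) + 4)) = 0 := by
      linear_combination hkl
    refine hlt.ne' ?_
    exact_mod_cast sub_eq_zero.1 ((mul_eq_zero.1 hfactor).resolve_left hne')
  exact ((Module.End.eigenspaces_iSupIndep _).comp eigenvalue_injective).mono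
    fun k => h.fischerSummand_le_eigenspace (by omega)

end Field

end IsFischerPair

end FischerPair

section SecondOrder

theorem exists_eq_C_of_isHomogeneous_zero {σ R : Type*} [CommSemiring R]
    {P : MvPolynomial σ R} (hP : P.IsHomogeneous 0) :
    ∃ c, P = C c :=
  ⟨_, totalDegree_eq_zero_iff_eq_C.1 ((totalDegree_zero_iff_isHomogeneous σ).2 hP)⟩

theorem eval_smul_of_isHomogeneous {σ R : Type*} [CommSemiring R] {P : MvPolynomial σ R} {n : ℕ}
    (hP : P.IsHomogeneous n) (t : R) (v : σ → R) : eval (t • v) P = t ^ n * eval v P := by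
  rw [eval_eq, eval_eq, Finset.mul_sum]
  refine Finset.sum_congr rfl fun d hd => ?_
  have hn : ∑ i ∈ d.support, d i = n := by
    rw [← hP (mem_support_iff.1 hd), Pi.one_def, ← Finsupp.degree_eq_weight_one,
      Finsupp.degree_apply]
  simp only [Pi.smul_apply, smul_eq_mul, mul_pow, Finset.prod_mul_distrib,
    Finset.prod_pow_eq_pow_sum, hn, mul_left_comm]

theorem derivation_sum_apply {R A M κ : Type*} [CommSemiring R] [CommSemiring A]
    [AddCommMonoid M] [Algebra R A] [Module A M] [Module R M] (D : κ → Derivation R A M)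
    (s : Finset κ) (a : A) : (∑ k ∈ s, D k) a = ∑ k ∈ s, D k a := by
  rw [← Finset.sum_apply]
  exact congrFun (map_sum Derivation.coeFnAddMonoidHom D s) a

variable {ι R : Type*} [Fintype ι] [CommRing R]

/-- The linear form with coefficient vector `a`, linearly in `a`. -/
noncomputable def linearForm : (ι → R) →ₗ[R] MvPolynomial ι R :=
  Fintype.linearCombination R X

/-- The derivative in the direction `u`, linearly in `u`. -/
noncomputable def dirDeriv :
    (ι → R) →ₗ[R] Derivation R (MvPolynomial ι R) (MvPolynomial ι R) :=
  Fintype.linearCombination R pderiv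

/-- The quadratic form `x B xᵀ` as a polynomial. -/
noncomputable def quadPoly (B : Matrix ι ι R) : MvPolynomial ι R :=
  ∑ i, ∑ j, C (B i j) * X i * X j

/-- The constant coefficient operator `∑ G j k ∂_j ∂_k`. -/
noncomputable def secondOrder (G : Matrix ι ι R) : MvPolynomial ι R →ₗ[R] MvPolynomial ι R :=
  ∑ j, ∑ k, G j k • ((pderiv j).toLinearMap ∘ₗ (pderiv k).toLinearMap)

/-- The gradient of `P` with respect to `G`, as the derivation `R ↦ ∑ G j k ∂_k P ∂_j R`. -/
noncomputable def gradField (G : Matrix ι ι R) (P : MvPolynomial ι R) :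
    Derivation R (MvPolynomial ι R) (MvPolynomial ι R) :=
  ∑ j, dirDeriv (G j) P • pderiv j

theorem linearForm_apply (a : ι → R) : linearForm a = ∑ i, C (a i) * X i := by
  simp [linearForm, Fintype.linearCombination_apply, smul_eq_C_mul]

theorem dirDeriv_apply (u : ι → R) (P : MvPolynomial ι R) :
    dirDeriv u P = ∑ i, u i • pderiv i P := by
  simp [dirDeriv, Fintype.linearCombination_apply, derivation_sum_apply]

theorem gradField_apply (G : Matrix ι ι R) (P S : MvPolynomial ι R) :
    gradField G P S = ∑ j, dirDeriv (G j) P * pderiv j S := by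
  simp [gradField, derivation_sum_apply]

theorem secondOrder_apply (G : Matrix ι ι R) (P : MvPolynomial ι R) :
    secondOrder G P = ∑ j, pderiv j (dirDeriv (G j) P) := by
  simp [secondOrder, dirDeriv_apply]

theorem quadPoly_eq_sum_X_mul (B : Matrix ι ι R) :
    quadPoly B = ∑ i, X i * linearForm (B i) := by
  simp only [quadPoly, linearForm_apply, Finset.mul_sum]
  exact Finset.sum_congr rfl fun i _ => Finset.sum_congr rfl fun j _ => by ring

theorem isHomogeneous_linearForm (a : ι → R) : (linearForm a).IsHomogeneous 1 := by
  rw [linearForm_apply]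
  exact IsHomogeneous.sum _ _ _ fun i _ => isHomogeneous_C_mul_X _ i

theorem isHomogeneous_quadPoly (B : Matrix ι ι R) : (quadPoly B).IsHomogeneous 2 :=
  IsHomogeneous.sum _ _ _ fun i _ => IsHomogeneous.sum _ _ _ fun j _ =>
    (isHomogeneous_C_mul_X _ i).mul (isHomogeneous_X R j)

theorem isHomogeneous_dirDeriv (u : ι → R) {P : MvPolynomial ι R} {d : ℕ}
    (hP : P.IsHomogeneous d) : (dirDeriv u P).IsHomogeneous (d - 1) := by
  rw [dirDeriv_apply]
  exact sum_mem fun i _ => (homogeneousSubmodule ι R (d - 1)).smul_mem _ hP.pderiv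

theorem isHomogeneous_secondOrder (G : Matrix ι ι R) {P : MvPolynomial ι R} {d : ℕ}
    (hP : P.IsHomogeneous (d + 2)) : (secondOrder G P).IsHomogeneous d := by
  rw [secondOrder_apply]
  exact IsHomogeneous.sum _ _ _ fun j _ => (isHomogeneous_dirDeriv (G j) hP).pderiv

theorem secondOrder_eq_zero_of_lt_two (G : Matrix ι ι R) {P : MvPolynomial ι R} {d : ℕ}
    (hP : P.IsHomogeneous d) (hd : d < 2) : secondOrder G P = 0 := by
  rw [secondOrder_apply]
  refine Finset.sum_eq_zero fun j _ => ?_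
  have hdP := isHomogeneous_dirDeriv (G j) hP
  rw [show d - 1 = 0 by omega] at hdP
  obtain ⟨c, hc⟩ := exists_eq_C_of_isHomogeneous_zero hdP
  rw [hc, pderiv_C]

theorem dirDeriv_X (u : ι → R) (i : ι) : dirDeriv u (X i) = C (u i) := by
  classical
  simp [dirDeriv_apply, pderiv_X, Pi.single_apply, smul_eq_C_mul]

theorem dirDeriv_linearForm (u a : ι → R) : dirDeriv u (linearForm a) = C (u ⬝ᵥ a) := by
  simp [linearForm_apply, dirDeriv_X, dotProduct, Derivation.leibniz, mul_comm]

theorem dirDeriv_comm (u v : ι → R) (P : MvPolynomial ι R) :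
    dirDeriv u (dirDeriv v P) = dirDeriv v (dirDeriv u P) := by
  have hbracket : ⁅dirDeriv u, dirDeriv v⁆ = 0 :=
    derivation_ext fun i => by simp [Derivation.commutator_apply, dirDeriv_X]
  rw [← sub_eq_zero, ← Derivation.commutator_apply, hbracket, Derivation.zero_apply]

theorem pderiv_eq_dirDeriv [DecidableEq ι] (i : ι) :
    (pderiv i : Derivation R (MvPolynomial ι R) _) = dirDeriv (Pi.single i 1) := by
  simp [dirDeriv, Fintype.linearCombination_apply_single]

theorem secondOrder_dirDeriv (G : Matrix ι ι R) (u : ι → R) (P : MvPolynomial ι R) :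
    secondOrder G (dirDeriv u P) = dirDeriv u (secondOrder G P) := by
  classical
  simp only [secondOrder_apply, map_sum, pderiv_eq_dirDeriv, dirDeriv_comm _ u]

theorem secondOrder_transpose_mul {κ : Type*} [Fintype κ] (U H : Matrix κ ι R)
    (P : MvPolynomial ι R) :
    secondOrder (Uᵀ * H) P = ∑ k, dirDeriv (U k) (dirDeriv (H k) P) := by
  have hrow (i : ι) : dirDeriv ((Uᵀ * H) i) P = ∑ k, U k i • dirDeriv (H k) P := by
    have : (Uᵀ * H) i = ∑ k, U k i • H k := by
      ext j
      simp [Matrix.mul_apply]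
    rw [this, map_sum, derivation_sum_apply]
    simp only [map_smul, Derivation.smul_apply]
  simp only [secondOrder_apply, hrow, map_sum, Derivation.map_smul, dirDeriv_apply (U _)]
  exact Finset.sum_comm

theorem secondOrder_map {S : Type*} [CommRing S] (f : R →+* S) (G : Matrix ι ι R)
    (P : MvPolynomial ι R) : secondOrder (G.map f) (map f P) = map f (secondOrder G P) := by
  simp [secondOrder, smul_eq_C_mul, pderiv_map]

theorem map_mem_harmonic {S : Type*} [CommRing S] (f : R →+* S) {G : Matrix ι ι R} {d : ℕ}
    {P : MvPolynomial ι R} (hP : P ∈ harmonic (secondOrder G) d) :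
    map f P ∈ harmonic (secondOrder (G.map f)) d := by
  refine ⟨IsHomogeneous.map hP.1 f, LinearMap.mem_ker.2 ?_⟩
  rw [secondOrder_map, LinearMap.mem_ker.1 hP.2, map_zero]

theorem gradField_comm {G : Matrix ι ι R} (hG : G.IsSymm) (P S : MvPolynomial ι R) :
    gradField G P S = gradField G S P := by
  simp only [gradField_apply, dirDeriv_apply, Finset.sum_mul]
  rw [Finset.sum_comm]
  refine Finset.sum_congr rfl fun k _ => Finset.sum_congr rfl fun j _ => ?_
  rw [hG.apply k j, smul_mul_assoc, smul_mul_assoc, mul_comm]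

theorem secondOrder_mul {G : Matrix ι ι R} (hG : G.IsSymm) (P S : MvPolynomial ι R) :
    secondOrder G (P * S) = P * secondOrder G S + S * secondOrder G P + 2 * gradField G P S := by
  rw [two_mul]
  nth_rw 2 [gradField_comm hG]
  simp only [secondOrder_apply, gradField_apply, Derivation.leibniz, smul_eq_mul, map_add,
    Finset.mul_sum, ← Finset.sum_add_distrib]
  exact Finset.sum_congr rfl fun j _ => by ring

theorem gradField_linearForm (G : Matrix ι ι R) (a : ι → R) :
    gradField G (linearForm a) = dirDeriv (G *ᵥ a) := by
  refine derivation_ext fun i => ?_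
  classical
  simp only [gradField_apply, dirDeriv_linearForm, dirDeriv_X, pderiv_X, Pi.single_apply,
    mul_ite, mul_one, mul_zero, Finset.sum_ite_eq, Finset.mem_univ, if_true]
  rfl

theorem secondOrder_linearForm_mul {G : Matrix ι ι R} (hG : G.IsSymm) (a : ι → R)
    (P : MvPolynomial ι R) :
    secondOrder G (linearForm a * P) =
      linearForm a * secondOrder G P + 2 * dirDeriv (G *ᵥ a) P := by
  rw [secondOrder_mul hG, secondOrder_eq_zero_of_lt_two G (isHomogeneous_linearForm a) one_lt_two,
    mul_zero, add_zero, gradField_linearForm]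

theorem dirDeriv_quadPoly {B : Matrix ι ι R} (hB : B.IsSymm) (u : ι → R) :
    dirDeriv u (quadPoly B) = 2 * linearForm (B *ᵥ u) := by
  have hsum : ∑ i, linearForm (B i) * C (u i) = linearForm (B *ᵥ u) := by
    rw [← hB.eq, Matrix.mulVec_transpose, hB.eq, Matrix.vecMul_eq_sum, map_sum]
    simp only [map_smul, smul_eq_C_mul, mul_comm]
  have hsum' : ∑ i, X i * C (u ⬝ᵥ B i) = linearForm (B *ᵥ u) := by
    rw [linearForm_apply]
    simp only [Matrix.mulVec, dotProduct_comm u, mul_comm]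
  rw [quadPoly_eq_sum_X_mul, map_sum, two_mul]
  nth_rw 1 [← hsum']
  rw [← hsum, ← Finset.sum_add_distrib]
  exact Finset.sum_congr rfl fun i _ => by
    rw [Derivation.leibniz, dirDeriv_linearForm, dirDeriv_X, smul_eq_mul, smul_eq_mul]

variable [DecidableEq ι]

theorem dirDeriv_inv_quadPoly {B : Matrix ι ι R} (hB : B.IsSymm) (hdet : IsUnit B.det) (j : ι) :
    dirDeriv (B⁻¹ j) (quadPoly B) = 2 * X j := by
  have hrow : B *ᵥ B⁻¹ j = Pi.single j 1 := by
    rw [← hB.inv.eq]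
    ext i
    simpa [Matrix.one_apply, Pi.single_apply, Matrix.mul_apply, Matrix.mulVec, dotProduct] using
      congrFun₂ (Matrix.mul_nonsing_inv B hdet) i j
  rw [dirDeriv_quadPoly hB, hrow, linearForm, Fintype.linearCombination_apply_single, one_smul]

theorem secondOrder_quadPoly_mul {B : Matrix ι ι R} (hB : B.IsSymm) (hdet : IsUnit B.det)
    {d : ℕ} {P : MvPolynomial ι R} (hP : P.IsHomogeneous d) :
    secondOrder B⁻¹ (quadPoly B * P) =
      quadPoly B * secondOrder B⁻¹ P + ((4 * d + 2 * Fintype.card ι : ℕ) : R) • P := by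
  have hLq : secondOrder B⁻¹ (quadPoly B) = 2 * Fintype.card ι := by
    simp [secondOrder_apply, dirDeriv_inv_quadPoly hB hdet, two_mul]
  have hgrad : gradField B⁻¹ (quadPoly B) P = 2 * (d * P) := by
    simp only [gradField_apply, dirDeriv_inv_quadPoly hB hdet, mul_assoc, ← Finset.mul_sum,
      hP.sum_X_mul_pderiv, nsmul_eq_mul]
  rw [secondOrder_mul hB.inv, hLq, hgrad, smul_eq_C_mul, map_natCast]
  push_cast
  ring

theorem isFischerPair_quadPoly [Nonempty ι] {B : Matrix ι ι R}
    (hB : B.IsSymm) (hdet : IsUnit B.det) :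
    IsFischerPair (quadPoly B) (secondOrder B⁻¹) (2 * Fintype.card ι) where
  pos := by positivity
  isHomogeneous := isHomogeneous_quadPoly B
  map_isHomogeneous := isHomogeneous_secondOrder _
  map_eq_zero := secondOrder_eq_zero_of_lt_two _
  map_mul := secondOrder_quadPoly_mul hB hdet

end SecondOrder

section LinSubst

variable {ι R : Type*} [Fintype ι] [CommRing R]

/-- The substitution `P(x) ↦ P(x U)`. -/
noncomputable def linSubst (U : Matrix ι ι R) : MvPolynomial ι R →ₐ[R] MvPolynomial ι R :=
  aeval fun j => ∑ i, C (U i j) * X i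

theorem linSubst_X (U : Matrix ι ι R) (j : ι) : linSubst U (X j) = linearForm (Uᵀ j) := by
  simp [linSubst, linearForm_apply]

theorem eval_linSubst (U : Matrix ι ι R) (P : MvPolynomial ι R) (v : ι → R) :
    eval v (linSubst U P) = eval (v ᵥ* U) P := by
  have : (aeval v).comp (linSubst U) = aeval (v ᵥ* U) :=
    algHom_ext fun j => by simp [linSubst, Matrix.vecMul, dotProduct, mul_comm]
  exact DFunLike.congr_fun this P

theorem linSubst_linearForm (U : Matrix ι ι R) (a : ι → R) :
    linSubst U (linearForm a) = linearForm (U *ᵥ a) := by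
  rw [Matrix.mulVec_eq_sum, map_sum]
  simp [linearForm_apply a, ← smul_eq_C_mul, linSubst_X]

theorem linSubst_linSubst (U W : Matrix ι ι R) (P : MvPolynomial ι R) :
    linSubst U (linSubst W P) = linSubst (U * W) P := by
  have : (linSubst U).comp (linSubst W) = linSubst (U * W) :=
    algHom_ext fun j => by
      rw [AlgHom.comp_apply, linSubst_X, linSubst_X, linSubst_linearForm, Matrix.transpose_mul,
        Matrix.mul_apply_eq_vecMul, Matrix.vecMul_transpose]
  exact DFunLike.congr_fun this P

theorem isHomogeneous_linSubst (U : Matrix ι ι R) {P : MvPolynomial ι R} {d : ℕ}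
    (hP : P.IsHomogeneous d) : (linSubst U P).IsHomogeneous d := by
  have := hP.aeval (fun j => ∑ i, C (U i j) * X i) (n := 1)
    fun j => IsHomogeneous.sum _ _ _ fun i _ => isHomogeneous_C_mul_X _ i
  rwa [one_mul] at this

theorem dirDeriv_linSubst (U : Matrix ι ι R) (u : ι → R) (P : MvPolynomial ι R) :
    dirDeriv u (linSubst U P) = linSubst U (dirDeriv (u ᵥ* U) P) := by
  induction P using MvPolynomial.induction_on with
  | C a => simp [← algebraMap_eq]
  | add P S hP hS => simp only [map_add, hP, hS]
  | mul_X P i hP =>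
    rw [map_mul, Derivation.leibniz, hP, linSubst_X, dirDeriv_linearForm, Derivation.leibniz,
      dirDeriv_X, map_add, smul_eq_mul, smul_eq_mul, smul_eq_mul, smul_eq_mul, map_mul, map_mul,
      linSubst_X, ← algebraMap_eq, AlgHom.commutes]
    rfl

theorem quadPoly_transpose_mul {κ : Type*} [Fintype κ] (U H : Matrix κ ι R) :
    quadPoly (Uᵀ * H) = ∑ k, linearForm (U k) * linearForm (H k) := by
  have hrow (i : ι) : linearForm ((Uᵀ * H) i) = ∑ k, U k i • linearForm (H k) := by
    rw [Matrix.mul_apply_eq_vecMul, Matrix.vecMul_eq_sum, map_sum]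
    simp only [map_smul, Matrix.transpose_apply]
  simp only [quadPoly_eq_sum_X_mul, hrow, linearForm_apply (U _), Finset.mul_sum, Finset.sum_mul]
  rw [Finset.sum_comm]
  refine Finset.sum_congr rfl fun k _ => Finset.sum_congr rfl fun i _ => ?_
  rw [smul_eq_C_mul]
  ring

theorem linSubst_quadPoly (U B : Matrix ι ι R) :
    linSubst U (quadPoly B) = quadPoly (U * B * Uᵀ) := by
  have := quadPoly_transpose_mul Uᵀ (B * Uᵀ)
  rw [Matrix.transpose_transpose, ← mul_assoc] at this
  rw [this, quadPoly_eq_sum_X_mul, map_sum]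
  simp only [map_mul, linSubst_X, linSubst_linearForm, Matrix.mul_apply_eq_vecMul B,
    Matrix.vecMul_transpose]

theorem secondOrder_linSubst (G U : Matrix ι ι R) (P : MvPolynomial ι R) :
    secondOrder G (linSubst U P) = linSubst U (secondOrder (Uᵀ * G * U) P) := by
  classical
  rw [mul_assoc, secondOrder_transpose_mul, secondOrder_apply, map_sum]
  simp only [pderiv_eq_dirDeriv, dirDeriv_linSubst, Matrix.single_one_vecMul,
    Matrix.mul_apply_eq_vecMul, Matrix.row]

variable [DecidableEq ι]

theorem linSubst_one (P : MvPolynomial ι R) : linSubst 1 P = P := by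
  have : linSubst (1 : Matrix ι ι R) = AlgHom.id R _ := algHom_ext fun j => by
    simp [linSubst, Matrix.one_apply]
  exact DFunLike.congr_fun this P

theorem linSubst_linSubst_inv (U : GL ι R) (P : MvPolynomial ι R) :
    linSubst U.val (linSubst (U⁻¹).val P) = P := by
  rw [linSubst_linSubst, ← Units.val_mul, mul_inv_cancel, Units.val_one, linSubst_one]

theorem transpose_mul_inv_conj_mul (U : GL ι R) (B : Matrix ι ι R) :
    U.valᵀ * (U.val * B * U.valᵀ)⁻¹ * U.val = B⁻¹ := by
  have hU : IsUnit U.val.det := (Matrix.isUnit_iff_isUnit_det _).1 U.isUnit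
  rw [Matrix.mul_inv_rev, Matrix.mul_inv_rev, ← mul_assoc,
    Matrix.mul_nonsing_inv _ (by rwa [Matrix.det_transpose]), one_mul, mul_assoc,
    Matrix.nonsing_inv_mul _ hU, mul_one]

theorem linSubst_mem_harmonic (U : GL ι R) (B : Matrix ι ι R) {d : ℕ} {P : MvPolynomial ι R}
    (hP : P ∈ harmonic (secondOrder B⁻¹) d) :
    linSubst U.val P ∈ harmonic (secondOrder (U.val * B * U.valᵀ)⁻¹) d := by
  refine ⟨isHomogeneous_linSubst _ hP.1, LinearMap.mem_ker.2 ?_⟩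
  rw [secondOrder_linSubst, transpose_mul_inv_conj_mul, LinearMap.mem_ker.1 hP.2, map_zero]

theorem map_linSubst_fischerSummand_le (U : GL ι R) (B : Matrix ι ι R) (d k : ℕ) :
    (fischerSummand (quadPoly B) (secondOrder B⁻¹) d k).map (linSubst U.val).toLinearMap ≤
      fischerSummand (quadPoly (U.val * B * U.valᵀ))
        (secondOrder (U.val * B * U.valᵀ)⁻¹) d k := by
  rintro _ ⟨_, ⟨H, hH, rfl⟩, rfl⟩
  exact ⟨linSubst U.val H, linSubst_mem_harmonic U B hH, by simp [linSubst_quadPoly]⟩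

end LinSubst

section QuadraticForm

variable {ι R : Type*} [Fintype ι] [CommRing R]

theorem eval_linearForm (a v : ι → R) : eval v (linearForm a) = a ⬝ᵥ v := by
  simp [linearForm_apply, dotProduct]

theorem eval_quadPoly (B : Matrix ι ι R) (v : ι → R) :
    eval v (quadPoly B) = v ⬝ᵥ B *ᵥ v := by
  simp [quadPoly_eq_sum_X_mul, eval_linearForm, dotProduct, Matrix.mulVec]

variable [DecidableEq ι] [Invertible (2 : R)]

theorem dotProduct_toMatrix'_mulVec (Q : QuadraticForm R (ι → R)) (v : ι → R) :
    v ⬝ᵥ Q.toMatrix' *ᵥ v = Q v := by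
  rw [← Matrix.toLinearMap₂'_apply', QuadraticForm.toMatrix', Matrix.toLinearMap₂'_toMatrix',
    QuadraticMap.associated_eq_self_apply]

theorem toMatrix'_eq_of_forall {Q : QuadraticForm R (ι → R)} {M : Matrix ι ι R} (hM : M.IsSymm)
    (h : ∀ v, Q v = v ⬝ᵥ M *ᵥ v) : Q.toMatrix' = M := by
  ext i j
  rw [QuadraticForm.toMatrix', LinearMap.toMatrix₂'_apply, QuadraticMap.associated_apply]
  simp only [h, Matrix.mulVec_add, add_dotProduct, dotProduct_add, Matrix.mulVec_single_one,
    single_one_dotProduct, Matrix.col_apply, hM.apply i j]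
  rw [Module.End.smul_def, QuadraticMap.half_moduleEnd_apply_eq_half_smul, smul_eq_mul,
    invOf_mul_eq_iff_eq_mul_left]
  ring

end QuadraticForm

section Quadric

variable {Q : QuadraticForm ℂ C3}

theorem eval_formPoly (Q : QuadraticForm ℂ C3) (v : C3) : eval v (formPoly Q) = Q v :=
  (eval_quadPoly _ v).trans (dotProduct_toMatrix'_mulVec Q v)

theorem toMatrix'_conj_of_mem_orthogonalGroup {U : GL (Fin 3) ℂ} (hU : U ∈ orthogonalGroup Q) :
    U.val * Q.toMatrix' * U.valᵀ = Q.toMatrix' := by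
  refine (toMatrix'_eq_of_forall ?_ fun v => ?_).symm
  · rw [Matrix.IsSymm, Matrix.transpose_mul, Matrix.transpose_mul, Matrix.transpose_transpose,
      QuadraticForm.isSymm_toMatrix' Q, mul_assoc]
  · rw [← hU v, ← dotProduct_toMatrix'_mulVec, mul_assoc, ← Matrix.mulVec_mulVec,
      ← Matrix.mulVec_mulVec, Matrix.dotProduct_mulVec v, Matrix.mulVec_transpose]

theorem map_substMatrix_summand {U : GL (Fin 3) ℂ} (hU : U ∈ orthogonalGroup Q) (d k : ℕ) :
    (summand Q d k).map (substMatrix U).toLinearMap = summand Q d k := by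
  have hle {W : GL (Fin 3) ℂ} (hW : W ∈ orthogonalGroup Q) :
      (summand Q d k).map (substMatrix W).toLinearMap ≤ summand Q d k := by
    have := map_linSubst_fischerSummand_le W Q.toMatrix' d k
    rwa [toMatrix'_conj_of_mem_orthogonalGroup hW] at this
  refine le_antisymm (hle hU) fun P hP => ?_
  exact ⟨substMatrix U⁻¹ P, hle (inv_mem hU) ⟨P, hP, rfl⟩, linSubst_linSubst_inv U P⟩

namespace ReducesToSquares

variable {A : GL (Fin 3) ℂ}

theorem mul_transpose_eq (h : ReducesToSquares Q A) : A.val * A.valᵀ = Q.toMatrix' := by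
  refine (toMatrix'_eq_of_forall (Matrix.isSymm_mul_transpose_self _) fun v => ?_).symm
  rw [h v, ← Matrix.mulVec_mulVec, Matrix.dotProduct_mulVec v, Matrix.mulVec_transpose]
  simp only [dotProduct, sq]

theorem isUnit_det_toMatrix' (h : ReducesToSquares Q A) : IsUnit Q.toMatrix'.det := by
  have hA := (Matrix.isUnit_iff_isUnit_det A.val).1 A.isUnit
  rw [← h.mul_transpose_eq, Matrix.det_mul, Matrix.det_transpose]
  exact hA.mul hA

theorem isFischerPair (h : ReducesToSquares Q A) :
    IsFischerPair (formPoly Q) (laplacian Q) (2 * Fintype.card (Fin 3)) :=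
  isFischerPair_quadPoly (QuadraticForm.isSymm_toMatrix' Q) h.isUnit_det_toMatrix'

theorem inv_mul_toMatrix'_mul (h : ReducesToSquares Q A) :
    (A⁻¹).val * Q.toMatrix' * (A⁻¹).valᵀ = 1 := by
  rw [← h.mul_transpose_eq, ← mul_assoc, ← Units.val_mul, inv_mul_cancel, Units.val_one, one_mul,
    ← Matrix.transpose_mul, ← Units.val_mul, inv_mul_cancel, Units.val_one, Matrix.transpose_one]

theorem linSubst_inv_mem_harmonic (h : ReducesToSquares Q A) {d : ℕ} {P : Poly}
    (hP : P ∈ Har Q d) : linSubst (A⁻¹).val P ∈ harmonic (secondOrder 1) d := by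
  have := linSubst_mem_harmonic A⁻¹ Q.toMatrix' hP
  rwa [h.inv_mul_toMatrix'_mul, inv_one] at this

theorem apply_vecMul_inv (h : ReducesToSquares Q A) (v : C3) :
    Q (v ᵥ* (A⁻¹).val) = ∑ i, v i ^ 2 := by
  rw [h, Matrix.vecMul_vecMul, ← Units.val_mul, inv_mul_cancel, Units.val_one, Matrix.vecMul_one]

end ReducesToSquares

theorem exists_reducesToSquares
    (hQ : LinearMap.Nondegenerate (QuadraticMap.associated (R := ℂ) Q)) :
    ∃ A : GL (Fin 3) ℂ, ReducesToSquares Q A := by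
  have h := QuadraticForm.equivalent_weightedSumSquares_of_isAlgClosed Q hQ.1
  rw [Module.finrank_fin_fun] at h
  obtain ⟨e⟩ := h
  set f : C3 ≃ₗ[ℂ] C3 := e.toLinearEquiv
  refine ⟨⟨(LinearMap.toMatrix' f.toLinearMap)ᵀ, (LinearMap.toMatrix' f.symm.toLinearMap)ᵀ, ?_, ?_⟩,
    fun v => ?_⟩
  · rw [← Matrix.transpose_mul, ← LinearMap.toMatrix'_comp]; simp
  · rw [← Matrix.transpose_mul, ← LinearMap.toMatrix'_comp]; simp
  · rw [Matrix.vecMul_transpose, LinearMap.toMatrix'_mulVec]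
    have he := e.map_app v
    simp only [QuadraticMap.weightedSumSquares_apply, Pi.one_apply, one_smul, ← sq] at he
    exact he.symm

end Quadric

section Quadrics

theorem dvd_derivation_of_mul_self_dvd {R A : Type*} [CommSemiring R] [CommSemiring A]
    [Algebra R A] (D : Derivation R A A) {g P : A} (h : g * g ∣ P) : g ∣ D P := by
  obtain ⟨S, rfl⟩ := h
  rw [Derivation.leibniz, Derivation.leibniz, smul_eq_mul, smul_eq_mul, smul_eq_mul]
  exact dvd_add (Dvd.intro _ (mul_assoc g g _).symm)
    (((dvd_mul_right g _).add (dvd_mul_right g _)).mul_left S)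

variable {ι K : Type*} [Fintype ι] [DecidableEq ι] [Field K]

-- A square factor divides the gradient, whose entries are multiples of the variables.
theorem squarefree_quadPoly_sub_C [Nontrivial ι] [NeZero (2 : K)] {B : Matrix ι ι K}
    (hB : B.IsSymm) (hdet : IsUnit B.det) (c : K) : Squarefree (quadPoly B - C c) := by
  intro g hg
  have hgX (j : ι) : g ∣ X j := by
    have := dvd_derivation_of_mul_self_dvd (dirDeriv (B⁻¹ j)) hg
    rw [map_sub, dirDeriv_inv_quadPoly hB hdet, derivation_C, sub_zero] at this
    have h2 : IsUnit (2 : MvPolynomial ι K) := by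
      rw [← map_ofNat (C : K →+* MvPolynomial ι K) 2]
      exact (isUnit_iff_ne_zero.2 two_ne_zero).map C
    exact h2.dvd_mul_left.1 this
  obtain ⟨i, j, hij⟩ := exists_pair_ne ι
  refine ((X_prime (i := i)).irreducible.dvd_iff.1 (hgX i)).resolve_right fun hassoc => hij ?_
  simpa using X_dvd_X.1 (hassoc.dvd.trans (hgX j))

theorem quadPoly_sub_C_dvd [Nontrivial ι] [NeZero (2 : K)] [IsAlgClosed K] {B : Matrix ι ι K}
    (hB : B.IsSymm) (hdet : IsUnit B.det) {c : K} {P : MvPolynomial ι K}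
    (h : ∀ v, v ⬝ᵥ B *ᵥ v = c → eval v P = 0) : quadPoly B - C c ∣ P := by
  have hrad := isRadical_iff_span_singleton.1 (squarefree_quadPoly_sub_C hB hdet c).isRadical
  rw [← Ideal.mem_span_singleton, ← hrad.radical,
    ← vanishingIdeal_zeroLocus_eq_radical (K := K), mem_vanishingIdeal_iff]
  refine fun v hv => h v ?_
  have hv0 : eval v (quadPoly B - C c) = 0 := hv _ (Ideal.mem_span_singleton_self _)
  simpa [eval_quadPoly, sub_eq_zero] using hv0

theorem existsUnique_secondOrder_eq_and_eval_eq [Nontrivial ι] [CharZero K] [IsAlgClosed K]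
    {B : Matrix ι ι K} (hB : B.IsSymm) (hdet : IsUnit B.det) (c : K) (M N : MvPolynomial ι K) :
    ∃! P, secondOrder B⁻¹ P = M ∧ ∀ v, v ⬝ᵥ B *ᵥ v = c → eval v P = eval v N := by
  obtain ⟨hinj, hsurj⟩ := (isFischerPair_quadPoly hB hdet).bijective_map_sub_C_mul c
  obtain ⟨R, hR⟩ := hsurj (M - secondOrder B⁻¹ N)
  replace hR : secondOrder B⁻¹ ((quadPoly B - C c) * R) = M - secondOrder B⁻¹ N := hR
  refine ⟨N + (quadPoly B - C c) * R, ⟨by rw [map_add, hR, add_sub_cancel], fun v hv => ?_⟩, ?_⟩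
  · simp [eval_quadPoly, hv]
  · rintro P ⟨hPM, hPN⟩
    obtain ⟨S, hS⟩ : quadPoly B - C c ∣ P - N :=
      quadPoly_sub_C_dvd hB hdet fun v hv => by simp [hPN v hv]
    have hSR : S = R := hinj <| by
      change secondOrder B⁻¹ ((quadPoly B - C c) * S) = secondOrder B⁻¹ ((quadPoly B - C c) * R)
      rw [hR, ← hS, map_sub, hPM]
    rw [← hSR, ← hS, add_sub_cancel]

theorem ReducesToSquares.existsUnique_laplacian_eq_and_eval_eq {Q : QuadraticForm ℂ C3}
    {A : GL (Fin 3) ℂ} (hA : ReducesToSquares Q A) (c : ℂ) (M N : Poly) :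
    ∃! P : Poly, laplacian Q P = M ∧ ∀ v ∈ surface Q c, eval v P = eval v N := by
  have := existsUnique_secondOrder_eq_and_eval_eq (QuadraticForm.isSymm_toMatrix' Q)
    hA.isUnit_det_toMatrix' c M N
  simp only [dotProduct_toMatrix'_mulVec] at this
  exact this

end Quadrics

section Conic

theorem exists_mul_eq_and_natDegree_eq {K : Type*} [Field K] [IsAlgClosed K] (p : Polynomial K)
    {k : ℕ} (hk : k ≤ p.natDegree) : ∃ s t, s * t = p ∧ s.natDegree = k := by
  induction k with
  | zero => exact ⟨1, p, one_mul p, Polynomial.natDegree_one⟩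
  | succ k ih =>
    obtain ⟨s, t, rfl, hs⟩ := ih (Nat.le_of_succ_le hk)
    have hs0 : s ≠ 0 := by rintro rfl; simp at hk
    have ht : t.degree ≠ 0 := fun h0 => by
      have := Polynomial.natDegree_mul_le (p := s) (q := t)
      rw [hs, Polynomial.natDegree_eq_zero_iff_degree_le_zero.2 h0.le] at this
      omega
    obtain ⟨z, hz⟩ := IsAlgClosed.exists_root t ht
    obtain ⟨t', rfl⟩ := Polynomial.dvd_iff_isRoot.2 hz
    refine ⟨s * (Polynomial.X - Polynomial.C z), t', mul_assoc _ _ _, ?_⟩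
    rw [Polynomial.natDegree_mul hs0 (Polynomial.X_sub_C_ne_zero z), hs,
      Polynomial.natDegree_X_sub_C]

theorem exists_prod_eq_and_natDegree_le {K : Type*} [Field K] [IsAlgClosed K] (k n : ℕ)
    {p : Polynomial K} (hp : p.natDegree ≤ k * (n + 1)) :
    ∃ q : Fin (n + 1) → Polynomial K, ∏ i, q i = p ∧ ∀ i, (q i).natDegree ≤ k := by
  induction n generalizing p with
  | zero => exact ⟨fun _ => p, by simp, fun _ => by simpa using hp⟩
  | succ n ih =>
    rcases le_or_gt p.natDegree k with hpk | hpk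
    · refine ⟨Fin.cons p fun _ => 1, by simp [Fin.prod_univ_succ], Fin.cases hpk fun _ => ?_⟩
      simp
    · obtain ⟨s, t, rfl, hs⟩ := exists_mul_eq_and_natDegree_eq p hpk.le
      have hst : s * t ≠ 0 := fun h0 => by simp [h0] at hpk
      rw [Polynomial.natDegree_mul (left_ne_zero_of_mul hst) (right_ne_zero_of_mul hst), hs,
        mul_add_one, add_comm k, Nat.add_le_add_iff_right] at hp
      obtain ⟨q, rfl, hq⟩ := ih hp
      exact ⟨Fin.cons s q, by simp [Fin.prod_univ_succ], Fin.cases hs.le hq⟩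

/-- The parametrization by pairs `(s, t)` of the isotropic cone `x² + y² + z² = 0`, over any
`ℂ`-algebra, so that it applies to points and to polynomials in a parameter. -/
noncomputable def conicPoint {R : Type*} [CommRing R] [Algebra ℂ R] (s t : R) : Fin 3 → R :=
  ![s ^ 2 - t ^ 2, Complex.I • (s ^ 2 + t ^ 2), (2 : ℂ) • (s * t)]

theorem exists_conicPoint_eq {v : C3} (hv : ∑ i, v i ^ 2 = 0) :
    ∃ s t : ℂ, conicPoint s t = v := by
  obtain ⟨s, hs⟩ := IsAlgClosed.exists_pow_nat_eq ((v 0 - Complex.I * v 1) / 2) two_pos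
  obtain ⟨t, ht⟩ := IsAlgClosed.exists_pow_nat_eq (-(v 0 + Complex.I * v 1) / 2) two_pos
  have hI := Complex.I_sq
  rw [Fin.sum_univ_three] at hv
  have hsq : (2 * (s * t)) ^ 2 = v 2 ^ 2 := by
    linear_combination 4 * t ^ 2 * hs + 2 * (v 0 - Complex.I * v 1) * ht + v 1 ^ 2 * hI - hv
  have hpoint {t : ℂ} (ht : t ^ 2 = -(v 0 + Complex.I * v 1) / 2) (hst : 2 * (s * t) = v 2) :
      conicPoint s t = v := by
    refine funext fun i => ?_
    fin_cases i
    · change s ^ 2 - t ^ 2 = v 0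
      linear_combination hs - ht
    · change Complex.I * (s ^ 2 + t ^ 2) = v 1
      linear_combination Complex.I * hs + Complex.I * ht - v 1 * hI
    · exact hst
  rcases sq_eq_sq_iff_eq_or_eq_neg.1 hsq with h | h
  · exact ⟨s, t, hpoint ht h⟩
  · exact ⟨s, -t, hpoint (by rw [neg_sq, ht]) (by linear_combination -h)⟩

theorem map_aeval_conicPoint {R S : Type*} [CommRing R] [CommRing S] [Algebra ℂ R] [Algebra ℂ S]
    (φ : R →ₐ[ℂ] S) (s t : R) (P : Poly) :
    φ (aeval (conicPoint s t) P) = aeval (conicPoint (φ s) (φ t)) P := by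
  rw [comp_aeval_apply]
  congr 2
  refine funext fun i => ?_
  fin_cases i <;> simp [conicPoint]

theorem eval_conicPoint_eq_zero {F : Poly} {n : ℕ} (hF : F.IsHomogeneous n)
    (h : aeval (conicPoint (Polynomial.X : Polynomial ℂ) 1) F = 0) (s t : ℂ) :
    eval (conicPoint s t) F = 0 := by
  have hne (t : ℂ) (ht : t ≠ 0) : eval (conicPoint s t) F = 0 := by
    have hst : conicPoint s t = t ^ 2 • conicPoint (s / t) 1 := by
      refine funext fun i => ?_
      fin_cases i <;> simp [conicPoint] <;> field_simp
    have h1 : eval (conicPoint (s / t) 1) F = 0 := by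
      simpa [map_aeval_conicPoint, aeval_eq_eval] using congrArg (Polynomial.aeval (s / t)) h
    rw [hst, eval_smul_of_isHomogeneous hF, h1, mul_zero]
  have hpoly : aeval (conicPoint (Polynomial.C s) Polynomial.X) F = 0 := by
    refine mul_left_cancel₀ Polynomial.X_ne_zero (Polynomial.funext fun t => ?_)
    rw [mul_zero, Polynomial.eval_mul, Polynomial.eval_X, Polynomial.eval_zero]
    rcases eq_or_ne t 0 with rfl | ht
    · simp
    · have := map_aeval_conicPoint (Polynomial.aeval t) (Polynomial.C s) Polynomial.X F
      exact mul_eq_zero_of_right t (by simpa [aeval_eq_eval, hne t ht] using this)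
  simpa [map_aeval_conicPoint, aeval_eq_eval] using congrArg (Polynomial.aeval t) hpoly

theorem natDegree_aeval_conicPoint_le {P : Poly} {n : ℕ} (hP : P.IsHomogeneous n) :
    (aeval (conicPoint (Polynomial.X : Polynomial ℂ) 1) P).natDegree ≤ 2 * n := by
  rw [mul_comm]
  refine aeval_natDegree_le P hP.totalDegree_le _ fun i => ?_
  fin_cases i
  all_goals
    simp only [conicPoint, Fin.zero_eta, Fin.mk_one, Fin.reduceFinMk, Matrix.cons_val_zero,
      Matrix.cons_val_one, Matrix.cons_val]
    compute_degree!

theorem exists_aeval_conicPoint_linearForm_eq {q : Polynomial ℂ} (hq : q.natDegree ≤ 2) :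
    ∃ a : C3, aeval (conicPoint Polynomial.X 1) (linearForm a) = q := by
  refine ⟨![(q.coeff 2 - q.coeff 0) / 2, -Complex.I * (q.coeff 2 + q.coeff 0) / 2, q.coeff 1 / 2],
    ?_⟩
  conv_rhs => rw [Polynomial.as_sum_range_C_mul_X_pow' (p := q) (n := 3) (by omega)]
  refine Polynomial.funext fun s => ?_
  simp only [conicPoint, one_pow, mul_one, neg_mul, linearForm_apply, Fin.sum_univ_three,
    Matrix.cons_val_zero, Matrix.cons_val_one, Matrix.cons_val, map_add, map_mul, algHom_C,
    Polynomial.algebraMap_eq, aeval_X, Polynomial.eval_add, Polynomial.eval_mul, Polynomial.eval_C,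
    Polynomial.eval_sub, Polynomial.eval_pow, Polynomial.eval_X, Polynomial.eval_one,
    Polynomial.eval_smul, smul_eq_mul, Finset.sum_range_succ, Finset.range_one,
    Finset.sum_singleton, pow_zero, pow_one]
  linear_combination (-(q.coeff 2 + q.coeff 0) / 2 * (s ^ 2 + 1)) * Complex.I_sq

theorem exists_quadPoly_one_dvd_sub_prod {n : ℕ} {H : Poly} (hH : H.IsHomogeneous (n + 1)) :
    ∃ a : Fin (n + 1) → C3, quadPoly 1 ∣ H - ∏ i, linearForm (a i) := by
  obtain ⟨q, hHq, hq⟩ := exists_prod_eq_and_natDegree_le 2 n (natDegree_aeval_conicPoint_le hH)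
  choose a ha using fun i => exists_aeval_conicPoint_linearForm_eq (hq i)
  refine ⟨a, ?_⟩
  have hprod : (∏ i, linearForm (a i)).IsHomogeneous (n + 1) := by
    simpa using IsHomogeneous.prod Finset.univ _ (fun _ => 1) fun i _ =>
      isHomogeneous_linearForm (a i)
  have hzero :
      aeval (conicPoint (Polynomial.X : Polynomial ℂ) 1) (H - ∏ i, linearForm (a i)) = 0 := by
    simp only [map_sub, map_prod, ha, hHq, sub_self]
  have hdvd := quadPoly_sub_C_dvd (B := (1 : Matrix (Fin 3) (Fin 3) ℂ)) (c := 0)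
    (P := H - ∏ i, linearForm (a i)) Matrix.isSymm_one (by simp) fun v hv => by
      obtain ⟨s, t, rfl⟩ := exists_conicPoint_eq (v := v) (by simpa [dotProduct, sq] using hv)
      exact eval_conicPoint_eq_zero (hH.sub hprod) hzero s t
  rwa [C_0, sub_zero] at hdvd

theorem ReducesToSquares.exists_formPoly_dvd_sub_prod {Q : QuadraticForm ℂ C3} {A : GL (Fin 3) ℂ}
    (hA : ReducesToSquares Q A) {n : ℕ} {H : Poly} (hH : H.IsHomogeneous (n + 1)) :
    ∃ a : Fin (n + 1) → C3, formPoly Q ∣ H - ∏ i, linearForm (a i) := by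
  obtain ⟨a, ha⟩ := exists_quadPoly_one_dvd_sub_prod (isHomogeneous_linSubst (A⁻¹).val hH)
  refine ⟨fun i => A.val *ᵥ a i, ?_⟩
  have hq : linSubst A.val (quadPoly 1) = formPoly Q := by
    rw [linSubst_quadPoly, mul_one, hA.mul_transpose_eq]
    rfl
  have := map_dvd (linSubst A.val) ha
  simpa only [hq, map_sub, linSubst_linSubst_inv, map_prod, linSubst_linearForm] using this

end Conic

section Multipole

variable {ι R : Type*} [Fintype ι] [CommRing R]

/-- With `N = card ι` and `n = us.length`, the polynomial `M` for which
`∇_{u₁} ⋯ ∇_{uₙ} (q ^ (1 - N / 2)) = M * q ^ (1 - N / 2 - n)`, where `q` is the quadratic form `B`;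
the recursion is the product rule. -/
noncomputable def multipole (B : Matrix ι ι R) : List (ι → R) → MvPolynomial ι R
  | [] => 1
  | u :: us => quadPoly B * dirDeriv u (multipole B us) +
      C (2 - Fintype.card ι - 2 * us.length : R) * (linearForm (B *ᵥ u) * multipole B us)

theorem dirDeriv_eq_zero_of_isHomogeneous_zero (u : ι → R) {P : MvPolynomial ι R}
    (hP : P.IsHomogeneous 0) : dirDeriv u P = 0 := by
  obtain ⟨c, rfl⟩ := exists_eq_C_of_isHomogeneous_zero hP
  exact (dirDeriv u).map_algebraMap c

theorem isHomogeneous_quadPoly_mul_dirDeriv (B : Matrix ι ι R) (u : ι → R) {P : MvPolynomial ι R}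
    {d : ℕ} (hP : P.IsHomogeneous d) : (quadPoly B * dirDeriv u P).IsHomogeneous (d + 1) := by
  rcases d with - | d
  · rw [dirDeriv_eq_zero_of_isHomogeneous_zero u hP, mul_zero]
    exact isHomogeneous_zero ι R _
  · rw [add_assoc, add_comm]
    exact (isHomogeneous_quadPoly B).mul (isHomogeneous_dirDeriv u hP)

variable [DecidableEq ι]

theorem secondOrder_quadPoly_mul_dirDeriv {B : Matrix ι ι R} (hB : B.IsSymm)
    (hdet : IsUnit B.det) (u : ι → R) {P : MvPolynomial ι R} {d : ℕ} (hP : P.IsHomogeneous d) :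
    secondOrder B⁻¹ (quadPoly B * dirDeriv u P) =
      quadPoly B * dirDeriv u (secondOrder B⁻¹ P) +
        C (4 * d - 4 + 2 * Fintype.card ι : R) * dirDeriv u P := by
  rcases d with - | d
  · rw [dirDeriv_eq_zero_of_isHomogeneous_zero u hP,
      secondOrder_eq_zero_of_lt_two _ hP two_pos]
    simp
  · rw [secondOrder_quadPoly_mul hB hdet (isHomogeneous_dirDeriv u hP), secondOrder_dirDeriv,
      smul_eq_C_mul, Nat.add_sub_cancel]
    congr 3
    push_cast
    ring

theorem multipole_mem_harmonic {B : Matrix ι ι R} (hB : B.IsSymm) (hdet : IsUnit B.det)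
    (us : List (ι → R)) : multipole B us ∈ harmonic (secondOrder B⁻¹) us.length := by
  induction us with
  | nil =>
    exact ⟨isHomogeneous_one ι R,
      secondOrder_eq_zero_of_lt_two _ (isHomogeneous_one ι R) two_pos⟩
  | cons u us ih =>
    obtain ⟨hM, hΔ⟩ : (multipole B us).IsHomogeneous us.length ∧
      secondOrder B⁻¹ (multipole B us) = 0 := ih
    have hinv : B⁻¹ *ᵥ B *ᵥ u = u := by
      rw [Matrix.mulVec_mulVec, Matrix.nonsing_inv_mul _ hdet, Matrix.one_mulVec]
    refine ⟨(isHomogeneous_quadPoly_mul_dirDeriv B u hM).add ?_, ?_⟩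
    · rw [add_comm]
      exact ((isHomogeneous_linearForm _).mul hM).C_mul _
    · change secondOrder B⁻¹ (multipole B (u :: us)) = 0
      rw [multipole, map_add, ← smul_eq_C_mul, map_smul, smul_eq_C_mul,
        secondOrder_quadPoly_mul_dirDeriv hB hdet u hM, secondOrder_linearForm_mul hB.inv, hinv, hΔ]
      simp only [map_zero, mul_zero, map_add, map_sub, map_mul, map_natCast, map_ofNat]
      ring

theorem exists_ne_zero_quadPoly_dvd_multipole_sub {ι K : Type*} [Fintype ι] [Field K] [CharZero K]
    (hι : 2 < Fintype.card ι) (B : Matrix ι ι K) (n : ℕ) :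
    ∃ c : K, c ≠ 0 ∧ ∀ us : List (ι → K), us.length = n →
      quadPoly B ∣ multipole B us - C c * (us.map fun u => linearForm (B *ᵥ u)).prod := by
  induction n with
  | zero =>
    refine ⟨1, one_ne_zero, fun us hus => ?_⟩
    simp [List.length_eq_zero_iff.1 hus, multipole]
  | succ n ih =>
    obtain ⟨c, hc, hdvd⟩ := ih
    have hne : (2 - Fintype.card ι - 2 * n : K) ≠ 0 := by
      rw [sub_sub, sub_ne_zero]
      exact_mod_cast (show 2 ≠ Fintype.card ι + 2 * n by omega)
    refine ⟨(2 - Fintype.card ι - 2 * n) * c, mul_ne_zero hne hc, ?_⟩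
    rintro (- | ⟨u, us⟩) hus
    · simp at hus
    obtain rfl : us.length = n := Nat.succ_injective hus
    obtain ⟨S, hS⟩ := hdvd us rfl
    refine ⟨dirDeriv u (multipole B us) +
      C (2 - Fintype.card ι - 2 * us.length : K) * linearForm (B *ᵥ u) * S, ?_⟩
    rw [multipole, List.map_cons, List.prod_cons, C_mul]
    linear_combination C (2 - Fintype.card ι - 2 * us.length : K) * linearForm (B *ᵥ u) * hS

theorem ReducesToSquares.exists_multipole_eq {Q : QuadraticForm ℂ C3} {A : GL (Fin 3) ℂ}
    (hA : ReducesToSquares Q A) {n : ℕ} {H : Poly} (hH : H ∈ Har Q (n + 1)) :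
    ∃ u : Fin (n + 1) → C3, multipole Q.toMatrix' (List.ofFn u) = H := by
  set B := Q.toMatrix'
  have hsymm : B.IsSymm := QuadraticForm.isSymm_toMatrix' Q
  have hdet : IsUnit B.det := hA.isUnit_det_toMatrix'
  obtain ⟨c, hc, hdvd⟩ := exists_ne_zero_quadPoly_dvd_multipole_sub (by simp) B (n + 1)
  obtain ⟨a, ha⟩ := hA.exists_formPoly_dvd_sub_prod (IsHomogeneous.C_mul hH.1 c⁻¹)
  set u : Fin (n + 1) → C3 := fun i => B⁻¹ *ᵥ a i
  have hu : (List.map (fun u => linearForm (B *ᵥ u)) (List.ofFn u)).prod =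
      ∏ i, linearForm (a i) := by
    simp only [List.map_ofFn, List.prod_ofFn, Function.comp_apply, u, Matrix.mulVec_mulVec,
      Matrix.mul_nonsing_inv _ hdet, Matrix.one_mulVec]
  have hM := hdvd (List.ofFn u) List.length_ofFn
  rw [hu] at hM
  refine ⟨u, sub_eq_zero.1 <| (isFischerPair_quadPoly hsymm hdet).eq_zero_of_dvd ?_ ?_⟩
  · have hΔ : secondOrder B⁻¹ (multipole B (List.ofFn u)) = 0 :=
      (multipole_mem_harmonic hsymm hdet _).2
    have hΔH : secondOrder B⁻¹ H = 0 := hH.2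
    rw [map_sub, hΔ, hΔH, sub_zero]
  · have hcancel : C c * (C c⁻¹ * H) = H := by
      rw [← mul_assoc, ← C_mul, mul_inv_cancel₀ hc, C_1, one_mul]
    have := dvd_sub hM (ha.mul_left (C c))
    rwa [mul_sub, hcancel, sub_sub_sub_cancel_right] at this

end Multipole

section Maxwell

theorem hasDerivAt_eval_add_smul {ι 𝕜 : Type*} [Fintype ι] [NontriviallyNormedField 𝕜]
    (P : MvPolynomial ι 𝕜) (v u : ι → 𝕜) (t : 𝕜) :
    HasDerivAt (fun t : 𝕜 => eval (v + t • u) P) (eval (v + t • u) (dirDeriv u P)) t := by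
  induction P using MvPolynomial.induction_on with
  | C a => simpa using hasDerivAt_const t a
  | add p q hp hq => simpa only [map_add] using hp.fun_add hq
  | mul_X p k hp =>
    have hk : HasDerivAt (fun t : 𝕜 => (v + t • u) k) (u k) t := by
      simpa using ((hasDerivAt_id t).mul_const (u k)).const_add (v k)
    simpa [dirDeriv_X, mul_comm, add_comm] using hp.fun_mul hk

namespace IsSqrtBranch

variable {Q : QuadraticForm ℂ C3} {Ω : Set C3} {r : C3 → ℂ}

theorem apply_ne_zero (h : IsSqrtBranch Q Ω r) {v : C3} (hv : v ∈ Ω) : r v ≠ 0 :=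
  ne_zero_pow two_ne_zero <| (h.sq_eq v hv).trans_ne (h.ne_zero v hv)

theorem eventually_add_smul_mem (h : IsSqrtBranch Q Ω r) {v : C3} (hv : v ∈ Ω) (u : C3) :
    ∀ᶠ t : ℂ in nhds 0, v + t • u ∈ Ω := by
  have hcont : ContinuousAt (fun t : ℂ => v + t • u) 0 := by fun_prop
  exact hcont.eventually_mem (h.isOpen.mem_nhds (by simpa using hv))

theorem hasDerivAt_add_smul (h : IsSqrtBranch Q Ω r) {v : C3} (hv : v ∈ Ω) (u : C3) :
    HasDerivAt (fun t : ℂ => r (v + t • u)) (eval v (linearForm (Q.toMatrix' *ᵥ u)) / r v) 0 := by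
  have hdiff : DifferentiableAt ℂ (fun t : ℂ => r (v + t • u)) 0 := by
    have hr : DifferentiableAt ℂ r (v + (0 : ℂ) • u) :=
      h.holomorphic.differentiableAt (h.isOpen.mem_nhds (by simpa using hv))
    exact DifferentiableAt.comp (0 : ℂ) hr (by fun_prop)
  have hsq : (fun t : ℂ => r (v + t • u) ^ 2) =ᶠ[nhds 0]
      fun t => eval (v + t • u) (formPoly Q) := by
    filter_upwards [h.eventually_add_smul_mem hv u] with t ht
    rw [h.sq_eq _ ht, eval_formPoly]
  have hderiv := (hdiff.hasDerivAt.fun_pow 2).unique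
    ((hasDerivAt_eval_add_smul (formPoly Q) v u 0).congr_of_eventuallyEq hsq)
  have hq : dirDeriv u (formPoly Q) = 2 * linearForm (Q.toMatrix' *ᵥ u) :=
    dirDeriv_quadPoly (QuadraticForm.isSymm_toMatrix' Q) u
  simp only [zero_smul, add_zero, hq, map_mul, map_ofNat, Nat.cast_ofNat] at hderiv
  refine hdiff.hasDerivAt.congr_deriv ?_
  rw [eq_div_iff (h.apply_ne_zero hv)]
  linear_combination hderiv / 2

theorem hasDerivAt_eval_mul_inv_pow (h : IsSqrtBranch Q Ω r) {v : C3} (hv : v ∈ Ω) (u : C3)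
    (P : Poly) (n : ℕ) :
    HasDerivAt (fun t : ℂ => eval (v + t • u) P * (r (v + t • u) ^ (n + 1))⁻¹)
      (eval v (formPoly Q * dirDeriv u P -
        C ((n + 1 : ℕ) : ℂ) * (linearForm (Q.toMatrix' *ᵥ u) * P)) * (r v ^ (n + 3))⁻¹) 0 := by
  have hr := h.apply_ne_zero hv
  have hpow := (h.hasDerivAt_add_smul hv u).fun_pow (n + 1)
  have hinv := hpow.fun_inv (by simpa only [zero_smul, add_zero] using pow_ne_zero (n + 1) hr)
  refine ((hasDerivAt_eval_add_smul P v u 0).fun_mul hinv).congr_deriv ?_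
  simp only [zero_smul, add_zero, map_sub, map_mul, eval_C, eval_formPoly, ← h.sq_eq v hv,
    Nat.add_sub_cancel]
  field_simp
  ring

theorem iterDirDeriv_inv (h : IsSqrtBranch Q Ω r) (us : List C3) {v : C3} (hv : v ∈ Ω) :
    iterDirDeriv us (fun w => (r w)⁻¹) v =
      eval v (multipole Q.toMatrix' us) * (r v ^ (2 * us.length + 1))⁻¹ := by
  induction us generalizing v with
  | nil => simp [iterDirDeriv, multipole]
  | cons u us ih =>
    have hnear : (fun t : ℂ => iterDirDeriv us (fun w => (r w)⁻¹) (v + t • u)) =ᶠ[nhds 0]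
        fun t => eval (v + t • u) (multipole Q.toMatrix' us) *
          (r (v + t • u) ^ (2 * us.length + 1))⁻¹ := by
      filter_upwards [h.eventually_add_smul_mem hv u] with t ht using ih ht
    have hcoeff : (2 - Fintype.card (Fin 3) - 2 * us.length : ℂ) = -(2 * us.length + 1 : ℕ) := by
      push_cast [Fintype.card_fin]
      ring
    refine (hnear.deriv_eq.trans (h.hasDerivAt_eval_mul_inv_pow hv u _ _).deriv).trans ?_
    rw [multipole, hcoeff, C_neg, neg_mul, ← sub_eq_add_neg]
    rfl

end IsSqrtBranch

namespace ReducesToSquares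

variable {Q : QuadraticForm ℂ C3} {A : GL (Fin 3) ℂ}

theorem exists_C_mul_multipole_eq (hA : ReducesToSquares Q A) {n : ℕ} {H : Poly}
    (hH : H ∈ Har Q n) :
    ∃ (a : ℂ) (u : Fin n → C3), (n ≠ 0 → a = 1) ∧
      C a * multipole Q.toMatrix' (List.ofFn u) = H := by
  cases n with
  | zero =>
    obtain ⟨a, rfl⟩ := exists_eq_C_of_isHomogeneous_zero hH.1
    exact ⟨a, 0, fun h => absurd rfl h, by rw [List.ofFn_zero, multipole, mul_one]⟩
  | succ n =>
    obtain ⟨u, hu⟩ := hA.exists_multipole_eq hH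
    exact ⟨1, u, fun _ => rfl, by rw [hu, C_1, one_mul]⟩

theorem exists_eval_eq_sum_iterDirDeriv (hA : ReducesToSquares Q A) {d : ℕ} {P : Poly}
    (hP : P ∈ V d) :
    ∃ (a : ℂ) (u : (k : ℕ) → Fin (d - 2 * k) → C3),
      ∀ (Ω : Set C3) (r : C3 → ℂ), IsSqrtBranch Q Ω r →
        ∀ v ∈ Ω, eval v P = ∑ k ∈ Finset.range (d / 2 + 1),
          (if 2 * k = d then a else 1) * r v ^ (2 * (d - k) + 1) *
            iterDirDeriv (List.ofFn (u k)) (fun w => (r w)⁻¹) v := by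
  obtain ⟨H, hH, rfl⟩ := hA.isFischerPair.exists_eq_sum_pow_mul hP
  choose a u ha hu using fun k => hA.exists_C_mul_multipole_eq (hH k)
  refine ⟨a (d / 2), u, fun Ω r hr v hv => ?_⟩
  rw [map_sum]
  refine Finset.sum_congr rfl fun k hk => ?_
  have hkd : 2 * k ≤ d := by grind
  have hak : (if 2 * k = d then a (d / 2) else 1) = a k := by
    split_ifs with h
    · rw [← h, Nat.mul_div_cancel_left k two_pos]
    · exact (ha k (by omega)).symm
  have hexp : 2 * (d - k) + 1 = 2 * k + (2 * (d - 2 * k) + 1) := by omega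
  have hr0 := hr.apply_ne_zero hv
  rw [hak, hr.iterDirDeriv_inv _ hv, ← hu k, List.length_ofFn, hexp, pow_add, pow_mul,
    hr.sq_eq v hv]
  simp only [map_mul, map_pow, eval_C, eval_formPoly]
  field_simp

end ReducesToSquares

end Maxwell

section Sphere

section Green

variable {ι K : Type*} [Fintype ι] [Field K] [CharZero K]

/- The field `T ∇P - P ∇T` is divergence free and its product with the position vector is
`(m - n) P T`. -/
theorem map_mul_eq_zero_of_mem_harmonic [DecidableEq ι] {Λ : MvPolynomial ι K →ₗ[K] K}
    (hΛ : ∀ i P, Λ (pderiv i P) = Λ (X i * P)) {m n : ℕ} (hmn : m ≠ n) {P T : MvPolynomial ι K}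
    (hP : P ∈ harmonic (secondOrder 1) m) (hT : T ∈ harmonic (secondOrder 1) n) :
    Λ (P * T) = 0 := by
  have laplace {S : MvPolynomial ι K} {d : ℕ} (hS : S ∈ harmonic (secondOrder 1) d) :
      ∑ i, pderiv i (pderiv i S) = 0 := by
    have hrow (i : ι) : (1 : Matrix ι ι K) i = Pi.single i 1 :=
      funext fun _ => Matrix.one_eq_pi_single
    rw [← LinearMap.mem_ker.1 hS.2, secondOrder_apply]
    simp only [hrow, ← pderiv_eq_dirDeriv]
  have divergence : ∑ i, pderiv i (T * pderiv i P - P * pderiv i T) = 0 :=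
    calc _ = T * ∑ i, pderiv i (pderiv i P) - P * ∑ i, pderiv i (pderiv i T) := by
          rw [Finset.mul_sum, Finset.mul_sum, ← Finset.sum_sub_distrib]
          refine Finset.sum_congr rfl fun i _ => ?_
          rw [map_sub, pderiv_mul, pderiv_mul]
          ring
      _ = 0 := by rw [laplace hP, laplace hT, mul_zero, mul_zero, sub_zero]
  have euler : ∑ i, X i * (T * pderiv i P - P * pderiv i T) = ((m : K) - n) • (P * T) :=
    calc _ = T * ∑ i, X i * pderiv i P - P * ∑ i, X i * pderiv i T := by
          rw [Finset.mul_sum, Finset.mul_sum, ← Finset.sum_sub_distrib]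
          exact Finset.sum_congr rfl fun i _ => by ring
      _ = _ := by
          rw [IsHomogeneous.sum_X_mul_pderiv hP.1, IsHomogeneous.sum_X_mul_pderiv hT.1,
            smul_eq_C_mul, C_sub, map_natCast, map_natCast, nsmul_eq_mul, nsmul_eq_mul]
          ring
  have hzero : ((m : K) - n) * Λ (P * T) = 0 := by
    rw [← smul_eq_mul, ← map_smul, ← euler, map_sum]
    simp only [← hΛ]
    rw [← map_sum, divergence, map_zero]
  exact (mul_eq_zero.1 hzero).resolve_left (sub_ne_zero.2 (Nat.cast_injective.ne hmn))

end Green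

theorem integral_eq_integral_toSphere_mul {E : Type*} [NormedAddCommGroup E] [NormedSpace ℝ E]
    [FiniteDimensional ℝ E] [Nontrivial E] [MeasurableSpace E] [BorelSpace E] (μ : Measure E)
    [μ.IsAddHaarMeasure] {𝕜 : Type*} [RCLike 𝕜] {F : E → 𝕜} {f : Metric.sphere (0 : E) 1 → 𝕜}
    {g : ℝ → 𝕜} (hF : ∀ x r, 0 < r → F (r • x.val) = f x * g r) :
    ∫ x, F x ∂μ =
      (∫ x, f x ∂μ.toSphere) *
        ∫ r in Set.Ioi (0 : ℝ), r ^ (Module.finrank ℝ E - 1) • g r := by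
  set n := Module.finrank ℝ E - 1
  have hpolar (x : ({0}ᶜ : Set E)) :
      F x = f (homeomorphUnitSphereProd E x).1 * g (homeomorphUnitSphereProd E x).2 := by
    rw [← hF _ _ (homeomorphUnitSphereProd E x).2.2, ← homeomorphUnitSphereProd_symm_apply_coe,
      Homeomorph.symm_apply_apply]
  calc ∫ x, F x ∂μ = ∫ x : ({0}ᶜ : Set E), F x ∂(μ.comap (↑)) := by
        rw [integral_subtype_comap (measurableSet_singleton _).compl, restrict_compl_singleton]
    _ = ∫ p, f p.1 * g p.2 ∂(μ.toSphere.prod (.volumeIoiPow n)) := by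
        simp only [hpolar]
        exact μ.measurePreserving_homeomorphUnitSphereProd.integral_comp
          (Homeomorph.measurableEmbedding _) fun p => f p.1 * g p.2
    _ = (∫ x, f x ∂μ.toSphere) * ∫ r : Set.Ioi (0 : ℝ), g r ∂.volumeIoiPow n :=
        integral_prod_mul (L := 𝕜) f fun r : Set.Ioi (0 : ℝ) => g r
    _ = _ := by
        congr 1
        simp only [Measure.volumeIoiPow, ENNReal.ofReal]
        rw [integral_withDensity_eq_integral_smul
            (measurable_subtype_coe.pow_const n).real_toNNReal,
          integral_subtype_comap measurableSet_Ioi fun r : ℝ => Real.toNNReal (r ^ n) • g r]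
        refine setIntegral_congr_fun measurableSet_Ioi fun r (hr : 0 < r) => ?_
        simp only [NNReal.smul_def, Real.coe_toNNReal _ (pow_nonneg hr.le n)]

variable {ι : Type*}

/-- The inclusion `ℝⁿ → ℂⁿ`. -/
def complexify (x : EuclideanSpace ℝ ι) : ι → ℂ := fun i => x i

theorem continuous_complexify : Continuous (complexify (ι := ι)) := by
  unfold complexify
  fun_prop

theorem complexify_add_smul (x y : EuclideanSpace ℝ ι) (t : ℝ) :
    complexify (x + t • y) = complexify x + (t : ℂ) • complexify y := by
  ext i
  simp [complexify]

theorem complexify_smul (t : ℝ) (x : EuclideanSpace ℝ ι) :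
    complexify (t • x) = (t : ℂ) • complexify x := by
  ext i
  simp [complexify]

theorem complexify_single [DecidableEq ι] (i : ι) :
    complexify (EuclideanSpace.single i 1) = Pi.single i 1 := by
  ext j
  simp [complexify, Pi.single_apply, apply_ite]

theorem eval_complexify_map_conj (x : EuclideanSpace ℝ ι) (P : MvPolynomial ι ℂ) :
    eval (complexify x) (map (starRingEnd ℂ) P) = conj (eval (complexify x) P) := by
  have hx : conj ∘ complexify x = complexify x := funext fun i => Complex.conj_ofReal (x i)
  conv_lhs => rw [← hx]
  rw [eval_map]
  exact (eval₂_comp (starRingEnd ℂ) (complexify x) P).symm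

theorem continuous_eval_complexify (P : MvPolynomial ι ℂ) :
    Continuous fun x => eval (complexify x) P :=
  P.continuous_eval.comp continuous_complexify

variable [Fintype ι]

theorem continuous_eval_sphere (P : MvPolynomial ι ℂ) :
    Continuous fun x : Metric.sphere (0 : EuclideanSpace ℝ ι) 1 => eval (complexify x) P :=
  (continuous_eval_complexify P).comp continuous_subtype_val

theorem eq_zero_of_eval_sphere_eq_zero [Nonempty ι] {P : MvPolynomial ι ℂ} {d : ℕ}
    (hP : P.IsHomogeneous d)
    (h : ∀ x : Metric.sphere (0 : EuclideanSpace ℝ ι) 1, eval (complexify x) P = 0) :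
    P = 0 := by
  refine funext_set (fun _ => ((↑) : ℝ → ℂ) '' Set.Ioi 0)
    (fun _ => (Set.Ioi_infinite 0).image Complex.ofReal_injective.injOn) fun v hv => ?_
  choose y hy_pos hy using fun i => hv i (Set.mem_univ i)
  set x : EuclideanSpace ℝ ι := WithLp.toLp 2 y
  obtain ⟨i⟩ := ‹Nonempty ι›
  have hx : ‖x‖ ≠ 0 := norm_ne_zero_iff.2 fun hx0 => (hy_pos i).ne' (congrArg (· i) hx0)
  have hmem : ‖x‖⁻¹ • x ∈ Metric.sphere (0 : EuclideanSpace ℝ ι) 1 := by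
    simp [norm_smul, hx]
  have hv : v = (‖x‖ : ℂ) • complexify (‖x‖⁻¹ • x) := by
    rw [← complexify_smul, smul_smul, mul_inv_cancel₀ hx, one_smul]
    exact funext fun i => (hy i).symm
  rw [hv, eval_smul_of_isHomogeneous hP, h ⟨_, hmem⟩, mul_zero, map_zero]

theorem integrable_eval_sphere (P : MvPolynomial ι ℂ) :
    Integrable (fun x : Metric.sphere (0 : EuclideanSpace ℝ ι) 1 => eval (complexify x) P)
      (volume : Measure (EuclideanSpace ℝ ι)).toSphere :=
  (continuous_eval_sphere P).integrable_of_hasCompactSupport (.of_compactSpace _)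

/-- The integral of a polynomial over the unit sphere of `ℝⁿ`. -/
noncomputable def sphereIntegral : MvPolynomial ι ℂ →ₗ[ℂ] ℂ where
  toFun P := ∫ x, eval (complexify x) P ∂(volume : Measure (EuclideanSpace ℝ ι)).toSphere
  map_add' P T := by
    rw [← integral_add (integrable_eval_sphere P) (integrable_eval_sphere T)]
    simp only [map_add]
  map_smul' c P := by
    simp only [smul_eval, integral_const_mul, RingHom.id_apply, smul_eq_mul]

/-- The Gaussian weight, as a function of the radius. -/
noncomputable def gauss (r : ℝ) : ℝ := Real.exp (-(1 / 2) * r ^ 2)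

theorem continuous_gauss : Continuous gauss := by
  unfold gauss
  fun_prop

theorem gauss_pos (r : ℝ) : 0 < gauss r := Real.exp_pos _

theorem integrableOn_pow_mul_gauss (n : ℕ) :
    IntegrableOn (fun r : ℝ => r ^ n * gauss r) (Set.Ioi 0) := by
  have hn : (-1 : ℝ) < n := neg_one_lt_zero.trans_le n.cast_nonneg
  simpa only [Real.rpow_natCast, gauss] using
    (integrable_rpow_mul_exp_neg_mul_sq one_half_pos hn).integrableOn (s := Set.Ioi 0)

theorem integral_pow_mul_gauss_pos (n : ℕ) : 0 < ∫ r in Set.Ioi (0 : ℝ), r ^ n * gauss r := by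
  have hpos : ∀ r ∈ Set.Ioi (0 : ℝ), 0 < r ^ n * gauss r := fun r hr =>
    mul_pos (pow_pos hr _) (gauss_pos r)
  rw [setIntegral_pos_iff_support_of_nonneg_ae
    ((ae_restrict_mem measurableSet_Ioi).mono fun r hr => (hpos r hr).le)
    (integrableOn_pow_mul_gauss n),
    Set.inter_eq_right.2 fun r hr => Function.mem_support.2 (hpos r hr).ne', Real.volume_Ioi]
  exact ENNReal.zero_lt_top

theorem hasFDerivAt_gauss_norm {E : Type*} [NormedAddCommGroup E] [InnerProductSpace ℝ E] (x : E) :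
    HasFDerivAt (fun x => gauss ‖x‖) (-gauss ‖x‖ • innerSL ℝ x) x := by
  refine ((hasStrictFDerivAt_norm_sq x).hasFDerivAt.const_mul (-(1 / 2))).exp.congr_fderiv ?_
  ext v
  simp [gauss]

theorem hasLineDerivAt_eval_complexify {ι : Type*} [Finite ι] [DecidableEq ι]
    (P : MvPolynomial ι ℂ) (i : ι) (x : EuclideanSpace ℝ ι) :
    HasLineDerivAt ℝ (fun x => eval (complexify x) P) (eval (complexify x) (pderiv i P)) x
      (EuclideanSpace.single i 1) := by
  cases nonempty_fintype ι
  have h := (hasDerivAt_eval_add_smul P (complexify x) (Pi.single i 1) ((0 : ℝ) : ℂ)).comp_ofReal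
  rw [← pderiv_eq_dirDeriv] at h
  simpa [HasLineDerivAt, complexify_add_smul, complexify_single] using h

variable [Nonempty ι]

theorem integrable_norm_pow_mul_gauss (n : ℕ) :
    Integrable fun x : EuclideanSpace ℝ ι => ‖x‖ ^ n * gauss ‖x‖ := by
  rw [integrable_fun_norm_addHaar volume (f := fun r => r ^ n * gauss r)]
  simpa only [smul_eq_mul, ← mul_assoc, ← pow_add] using integrableOn_pow_mul_gauss _

theorem integrable_eval_mul_gauss (P : MvPolynomial ι ℂ) :
    Integrable fun x : EuclideanSpace ℝ ι => eval (complexify x) P * (gauss ‖x‖ : ℂ) := by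
  simp only [eval_eq', Finset.sum_mul]
  refine integrable_finsetSum _ fun d _ => ?_
  refine ((integrable_norm_pow_mul_gauss (∑ i, d i)).const_mul ‖coeff d P‖).mono' ?_
    (.of_forall fun x => ?_)
  · have := continuous_complexify (ι := ι)
    have := continuous_gauss
    exact Continuous.aestronglyMeasurable (by fun_prop)
  · have hmonomial : ∏ i, ‖complexify x i‖ ^ d i ≤ ‖x‖ ^ ∑ i, d i := by
      rw [← Finset.prod_pow_eq_pow_sum]
      gcongr with i
      rw [complexify, Complex.norm_real]
      exact PiLp.norm_apply_le x i
    rw [norm_mul, norm_mul, norm_prod, Complex.norm_real, Real.norm_of_nonneg (gauss_pos _).le,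
      mul_assoc]
    simp only [norm_pow]
    gcongr
    exact (gauss_pos _).le

/-- The Gaussian integral of a polynomial over `ℝⁿ`. -/
noncomputable def gaussIntegral : MvPolynomial ι ℂ →ₗ[ℂ] ℂ where
  toFun P := ∫ x : EuclideanSpace ℝ ι, eval (complexify x) P * (gauss ‖x‖ : ℂ)
  map_add' P T := by
    rw [← integral_add (integrable_eval_mul_gauss P) (integrable_eval_mul_gauss T)]
    simp only [map_add, add_mul]
  map_smul' c P := by
    simp only [smul_eval, mul_assoc, integral_const_mul, RingHom.id_apply, smul_eq_mul]

theorem gaussIntegral_pderiv (i : ι) (P : MvPolynomial ι ℂ) :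
    gaussIntegral (pderiv i P) = gaussIntegral (X i * P) := by
  classical
  have hgauss (x : EuclideanSpace ℝ ι) :
      HasLineDerivAt ℝ (fun x => (gauss ‖x‖ : ℂ)) (-(x i : ℂ) * (gauss ‖x‖ : ℂ)) x
        (EuclideanSpace.single i 1) := by
    simpa [HasLineDerivAt, mul_comm, EuclideanSpace.inner_single_right] using
      HasDerivAt.ofReal_comp ((hasFDerivAt_gauss_norm x).hasLineDerivAt (.single i 1))
  have hmul (x : EuclideanSpace ℝ ι) :
      eval (complexify x) P * (-(x i : ℂ) * (gauss ‖x‖ : ℂ)) =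
        -(eval (complexify x) (X i * P) * (gauss ‖x‖ : ℂ)) := by
    rw [map_mul, eval_X, complexify]
    ring
  have hparts := integral_bilinear_hasLineDerivAt_right_eq_neg_left_of_integrable
    (μ := (volume : Measure (EuclideanSpace ℝ ι))) (B := ContinuousLinearMap.mul ℝ ℂ)
    (integrable_eval_mul_gauss (pderiv i P))
    (by simpa only [ContinuousLinearMap.mul_apply', hmul] using
      (integrable_eval_mul_gauss (X i * P)).fun_neg)
    (integrable_eval_mul_gauss P)
    (fun x _ => hasLineDerivAt_eval_complexify P i x) (fun x _ => hgauss x)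
  simp only [ContinuousLinearMap.mul_apply', hmul, integral_neg, neg_inj] at hparts
  exact hparts.symm

theorem gaussIntegral_eq_sphereIntegral_mul {d : ℕ} {P : MvPolynomial ι ℂ}
    (hP : P.IsHomogeneous d) :
    gaussIntegral P = sphereIntegral P *
      (∫ r in Set.Ioi (0 : ℝ), r ^ (Fintype.card ι - 1 + d) * gauss r : ℝ) := by
  refine (integral_eq_integral_toSphere_mul volume (f := fun x => eval (complexify x) P)
    (g := fun r => (r ^ d * gauss r : ℝ)) fun x r hr => ?_).trans ?_
  · rw [complexify_smul, eval_smul_of_isHomogeneous hP, norm_smul, norm_eq_of_mem_sphere, mul_one,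
      Real.norm_of_nonneg hr.le]
    push_cast
    ring
  · rw [← integral_complex_ofReal, finrank_euclideanSpace]
    simp only [Complex.real_smul, pow_add, mul_assoc, Complex.ofReal_mul]
    rfl

theorem sphereIntegral_mul_eq_zero [DecidableEq ι] {m n : ℕ} (hmn : m ≠ n)
    {P T : MvPolynomial ι ℂ} (hP : P ∈ harmonic (secondOrder 1) m)
    (hT : T ∈ harmonic (secondOrder 1) n) : sphereIntegral (P * T) = 0 := by
  have h := map_mul_eq_zero_of_mem_harmonic gaussIntegral_pderiv hmn hP hT
  rw [gaussIntegral_eq_sphereIntegral_mul (IsHomogeneous.mul hP.1 hT.1)] at h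
  exact (mul_eq_zero.1 h).resolve_right
    (Complex.ofReal_ne_zero.2 (integral_pow_mul_gauss_pos _).ne')

end Sphere

section Hermitian

variable {Q : QuadraticForm ℂ C3} {A : GL (Fin 3) ℂ}

theorem isClosed_ellipsoid (Q : QuadraticForm ℂ C3) (A : GL (Fin 3) ℂ) :
    IsClosed (ellipsoid Q A) := by
  have hQ : Continuous Q := (funext (eval_formPoly Q)) ▸ (formPoly Q).continuous_eval
  have him (i : Fin 3) : Continuous fun v : C3 => ((v ᵥ* A.val) i).im :=
    Complex.continuous_im.comp
      ((continuous_apply i).comp (continuous_id.matrix_vecMul continuous_const))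
  have hreal : IsClosed {v : C3 | ∀ i, ((v ᵥ* A.val) i).im = 0} := by
    rw [Set.ofPred_forall]
    exact isClosed_iInter fun i => isClosed_eq (him i) continuous_const
  exact (isClosed_eq hQ continuous_const).inter hreal

theorem herm_formPoly_pow_mul (Q : QuadraticForm ℂ C3) (A : GL (Fin 3) ℂ) (k l : ℕ) (P T : Poly) :
    herm Q A (formPoly Q ^ k * P) (formPoly Q ^ l * T) = herm Q A P T := by
  refine setIntegral_congr_fun (isClosed_ellipsoid Q A).measurableSet fun v hv => ?_
  have hv : Q v = 1 := hv.1
  simp [eval_formPoly, hv]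

theorem conj_herm (Q : QuadraticForm ℂ C3) (A : GL (Fin 3) ℂ) (P T : Poly) :
    conj (herm Q A P T) = herm Q A T P := by
  rw [herm, herm, ← integral_conj]
  simp [mul_comm]

theorem herm_smul_right (Q : QuadraticForm ℂ C3) (A : GL (Fin 3) ℂ) (c : ℂ) (P T : Poly) :
    herm Q A P (c • T) = conj c * herm Q A P T := by
  rw [herm, herm, ← integral_const_mul]
  simp only [smul_eval, map_mul, mul_left_comm]

namespace ReducesToSquares

theorem vecMul_inv_mem_ellipsoid (hA : ReducesToSquares Q A)
    (x : Metric.sphere (0 : EuclideanSpace ℝ (Fin 3)) 1) :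
    complexify x ᵥ* (A⁻¹).val ∈ ellipsoid Q A := by
  refine ⟨(hA.apply_vecMul_inv _).trans ?_, fun i => ?_⟩
  · have hx : ∑ i, x.val i ^ 2 = 1 := by
      rw [← EuclideanSpace.real_norm_sq_eq, norm_eq_of_mem_sphere, one_pow]
    simp only [complexify]
    exact_mod_cast hx
  · rw [Matrix.vecMul_vecMul, ← Units.val_mul, inv_mul_cancel, Units.val_one, Matrix.vecMul_one]
    exact Complex.ofReal_im _

theorem herm_eq_sphereIntegral (hA : ReducesToSquares Q A) (P T : Poly) :
    herm Q A P T = sphereIntegral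
      (linSubst (A⁻¹).val P * map (starRingEnd ℂ) (linSubst (A⁻¹).val T)) := by
  set φ : Metric.sphere (0 : EuclideanSpace ℝ (Fin 3)) 1 → C3 :=
    fun x => complexify x ᵥ* (A⁻¹).val
  have hφ : Continuous φ :=
    (continuous_complexify.comp continuous_subtype_val).matrix_vecMul continuous_const
  have hPT : Continuous fun v : C3 => eval v P * conj (eval v T) :=
    P.continuous_eval.mul (Complex.continuous_conj.comp T.continuous_eval)
  have hpre : φ ⁻¹' ellipsoid Q A = Set.univ := Set.eq_univ_of_forall hA.vecMul_inv_mem_ellipsoid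
  calc herm Q A P T
    _ = ∫ x in φ ⁻¹' ellipsoid Q A, eval (φ x) P * conj (eval (φ x) T)
          ∂(volume : Measure (EuclideanSpace ℝ (Fin 3))).toSphere :=
        setIntegral_map (isClosed_ellipsoid Q A).measurableSet hPT.aestronglyMeasurable
          hφ.measurable.aemeasurable
    _ = sphereIntegral (linSubst (A⁻¹).val P * map (starRingEnd ℂ) (linSubst (A⁻¹).val T)) := by
        rw [hpre, Measure.restrict_univ]
        simp only [sphereIntegral, LinearMap.coe_mk, AddHom.coe_mk, map_mul,
          eval_complexify_map_conj, eval_linSubst, φ]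

theorem herm_add_left (hA : ReducesToSquares Q A) (P S T : Poly) :
    herm Q A (P + S) T = herm Q A P T + herm Q A S T := by
  simp only [hA.herm_eq_sphereIntegral, map_add, add_mul]

theorem herm_add_right (hA : ReducesToSquares Q A) (P S T : Poly) :
    herm Q A P (S + T) = herm Q A P S + herm Q A P T := by
  simp only [hA.herm_eq_sphereIntegral, map_add, mul_add]

theorem herm_sum_right (hA : ReducesToSquares Q A) {κ : Type*} (s : Finset κ) (P : Poly)
    (T : κ → Poly) : herm Q A P (∑ k ∈ s, T k) = ∑ k ∈ s, herm Q A P (T k) := by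
  simp only [hA.herm_eq_sphereIntegral, map_sum, Finset.mul_sum]

theorem herm_self (hA : ReducesToSquares Q A) (P : Poly) :
    herm Q A P P = (∫ x, Complex.normSq (eval (complexify x) (linSubst (A⁻¹).val P))
      ∂(volume : Measure (EuclideanSpace ℝ (Fin 3))).toSphere : ℝ) := by
  rw [hA.herm_eq_sphereIntegral, ← integral_complex_ofReal]
  simp only [sphereIntegral, LinearMap.coe_mk, AddHom.coe_mk, map_mul, eval_complexify_map_conj,
    Complex.mul_conj]

theorem eq_zero_of_herm_self (hA : ReducesToSquares Q A) {d : ℕ} {P : Poly}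
    (hP : P.IsHomogeneous d) (h : herm Q A P P = 0) : P = 0 := by
  have hcont : Continuous fun x : Metric.sphere (0 : EuclideanSpace ℝ (Fin 3)) 1 =>
      Complex.normSq (eval (complexify x) (linSubst (A⁻¹).val P)) :=
    Complex.continuous_normSq.comp (continuous_eval_sphere _)
  rw [hA.herm_self, Complex.ofReal_eq_zero,
    integral_eq_zero_iff_of_nonneg (fun x => Complex.normSq_nonneg _)
      (hcont.integrable_of_hasCompactSupport (.of_compactSpace _)),
    hcont.ae_eq_iff_eq _ continuous_zero] at h
  have hP0 : linSubst (A⁻¹).val P = 0 :=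
    eq_zero_of_eval_sphere_eq_zero (isHomogeneous_linSubst _ hP) fun x =>
      Complex.normSq_eq_zero.1 (congrFun h x)
  rw [← linSubst_linSubst_inv A P, hP0, map_zero]

theorem exists_innerProductCore (hA : ReducesToSquares Q A) (d : ℕ) :
    ∃ ip : InnerProductSpace.Core ℂ (V d), ∀ P T : V d, ip.inner T P = herm Q A P T :=
  ⟨{  inner T P := herm Q A P T
      conj_inner_symm P T := conj_herm Q A P T
      re_inner_nonneg P := by
        rw [hA.herm_self]
        exact integral_nonneg fun x => Complex.normSq_nonneg _
      add_left P S T := hA.herm_add_right T P S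
      smul_left P T c := herm_smul_right Q A c T P
      definite P hP := Subtype.ext (hA.eq_zero_of_herm_self P.2 hP) },
    fun _ _ => rfl⟩

theorem herm_eq_zero_of_mem_Har (hA : ReducesToSquares Q A) {m n : ℕ} (hmn : m ≠ n) {P T : Poly}
    (hP : P ∈ Har Q m) (hT : T ∈ Har Q n) : herm Q A P T = 0 := by
  have hconj := map_mem_harmonic (starRingEnd ℂ) (hA.linSubst_inv_mem_harmonic hT)
  rw [Matrix.map_one _ (map_zero _) (map_one _)] at hconj
  rw [hA.herm_eq_sphereIntegral]
  exact sphereIntegral_mul_eq_zero hmn (hA.linSubst_inv_mem_harmonic hP) hconj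

theorem herm_summand_eq_zero (hA : ReducesToSquares Q A) {d k l : ℕ} (hk : 2 * k ≤ d)
    (hl : 2 * l ≤ d) (hkl : k ≠ l) {P T : Poly} (hP : P ∈ summand Q d k)
    (hT : T ∈ summand Q d l) : herm Q A P T = 0 := by
  obtain ⟨G, hG, rfl⟩ := hP
  obtain ⟨H, hH, rfl⟩ := hT
  rw [LinearMap.mulLeft_apply, LinearMap.mulLeft_apply, herm_formPoly_pow_mul]
  exact hA.herm_eq_zero_of_mem_Har (by omega) hG hH

theorem herm_eq_zero_of_mem_VQ (hA : ReducesToSquares Q A) {d : ℕ} {P T : Poly}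
    (hP : P ∈ Har Q d) (hT : T ∈ VQ Q d) : herm Q A P T = 0 := by
  obtain ⟨H, hH, hTH⟩ := hA.isFischerPair.exists_eq_sum_pow_mul hT.1
  rw [Finset.sum_range_succ', pow_zero, one_mul] at hTH
  have hdvd : formPoly Q ∣ ∑ k ∈ Finset.range (d / 2), formPoly Q ^ (k + 1) * H (k + 1) :=
    Finset.dvd_sum fun k _ => (dvd_pow_self _ k.succ_ne_zero).mul_right _
  have hH0 : H 0 = 0 := by
    refine hA.isFischerPair.eq_zero_of_dvd (LinearMap.mem_ker.1 (hH 0).2) ?_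
    exact (dvd_add_right hdvd).1 (hTH ▸ Ideal.mem_span_singleton.1 hT.2)
  rw [hTH, hH0, add_zero, hA.herm_sum_right]
  refine Finset.sum_eq_zero fun k hk => ?_
  have hkd := Finset.mem_range.1 hk
  exact hA.herm_summand_eq_zero (k := 0) (by omega) (by omega) k.succ_ne_zero.symm
    ⟨P, hP, by simp⟩ ⟨H (k + 1), hH (k + 1), rfl⟩

theorem mem_Har_iff_forall_herm_eq_zero (hA : ReducesToSquares Q A) {d : ℕ} {P : Poly}
    (hP : P ∈ V d) : P ∈ Har Q d ↔ ∀ T ∈ VQ Q d, herm Q A P T = 0 := by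
  refine ⟨fun h T hT => hA.herm_eq_zero_of_mem_VQ h hT, fun h => ?_⟩
  obtain hlt | ⟨d, rfl⟩ := (lt_or_ge d 2).imp_right Nat.exists_eq_add_of_le'
  · exact ⟨hP, hA.isFischerPair.map_eq_zero hP hlt⟩
  obtain ⟨H, hH, R, hR, rfl⟩ := hA.isFischerPair.exists_harmonic_add_mul hP
  have hQR := hA.isFischerPair.mul_isHomogeneous hR
  have hmem : formPoly Q * R ∈ VQ Q (d + 2) :=
    ⟨hQR, Ideal.mem_span_singleton.2 (dvd_mul_right _ R)⟩
  have hself : herm Q A (formPoly Q * R) (formPoly Q * R) = 0 := by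
    rw [← h _ hmem, hA.herm_add_left, hA.herm_eq_zero_of_mem_VQ hH hmem, zero_add]
  rwa [hA.eq_zero_of_herm_self hQR hself, add_zero]

end ReducesToSquares

end Hermitian

end QHarmonic

theorem theorem12 (Q : QuadraticForm ℂ (Fin 3 → ℂ))
    (hQ : LinearMap.Nondegenerate (QuadraticMap.associated (R := ℂ) Q)) :
    -- the direct sum decomposition of `V(d)`
    (∀ d : ℕ,
      iSupIndep (fun k : Fin (d / 2 + 1) => QHarmonic.summand Q d k) ∧
      (⨆ k : Fin (d / 2 + 1), QHarmonic.summand Q d k) = QHarmonic.V d) ∧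
    -- its invariance under `O_Q(3; ℂ)`
    (∀ d : ℕ, ∀ U ∈ QHarmonic.orthogonalGroup Q, ∀ k : Fin (d / 2 + 1),
      (QHarmonic.summand Q d k).map (QHarmonic.substMatrix U).toLinearMap =
        QHarmonic.summand Q d k) ∧
    -- the Hermitian product over the ellipsoid, for every reduction of `Q` to a sum of squares
    (∃ A : GL (Fin 3) ℂ, QHarmonic.ReducesToSquares Q A) ∧
    (∀ A : GL (Fin 3) ℂ, QHarmonic.ReducesToSquares Q A → ∀ d : ℕ,
      (∃ ip : InnerProductSpace.Core ℂ (QHarmonic.V d),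
        ∀ P T : QHarmonic.V d, ip.inner T P = QHarmonic.herm Q A P T) ∧
      (∀ k l : Fin (d / 2 + 1), k ≠ l →
        ∀ P ∈ QHarmonic.summand Q d k, ∀ T ∈ QHarmonic.summand Q d l,
          QHarmonic.herm Q A P T = 0) ∧
      (∀ P ∈ QHarmonic.V d,
        P ∈ QHarmonic.Har Q d ↔ ∀ T ∈ QHarmonic.VQ Q d, QHarmonic.herm Q A P T = 0)) ∧
    -- polynomial functions on `{Q = c}` are restrictions of `Q`-harmonic polynomials
    (∀ (c : ℂ) (F : QHarmonic.Poly), ∃ P : QHarmonic.Poly,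
      QHarmonic.laplacian Q P = 0 ∧
      ∀ v ∈ QHarmonic.surface Q c, MvPolynomial.eval v P = MvPolynomial.eval v F) ∧
    -- the Dirichlet problem
    (∀ (c : ℂ) (M N : QHarmonic.Poly), ∃! P : QHarmonic.Poly,
      QHarmonic.laplacian Q P = M ∧
      ∀ v ∈ QHarmonic.surface Q c, MvPolynomial.eval v P = MvPolynomial.eval v N) ∧
    -- the Maxwell representation; a multipole without vectors is a scalar `a`
    (∀ d : ℕ, ∀ P ∈ QHarmonic.V d,
      ∃ (a : ℂ) (u : (k : ℕ) → Fin (d - 2 * k) → QHarmonic.C3),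
        ∀ (Ω : Set QHarmonic.C3) (r : QHarmonic.C3 → ℂ), QHarmonic.IsSqrtBranch Q Ω r →
          ∀ v ∈ Ω, MvPolynomial.eval v P =
            ∑ k ∈ Finset.range (d / 2 + 1),
              (if 2 * k = d then a else 1) * r v ^ (2 * (d - k) + 1) *
                QHarmonic.iterDirDeriv (List.ofFn (u k)) (fun w => (r w)⁻¹) v) := by
  obtain ⟨A, hA⟩ := QHarmonic.exists_reducesToSquares hQ
  refine ⟨fun d => ⟨hA.isFischerPair.iSupIndep_fischerSummand d,
      hA.isFischerPair.iSup_fischerSummand d⟩,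
    fun d U hU k => QHarmonic.map_substMatrix_summand hU d k, ⟨A, hA⟩,
    fun A hA d => ⟨hA.exists_innerProductCore d, ?_,
      fun P hP => hA.mem_Har_iff_forall_herm_eq_zero hP⟩,
    fun c F => (hA.existsUnique_laplacian_eq_and_eval_eq c 0 F).exists,
    hA.existsUnique_laplacian_eq_and_eval_eq,
    fun d P hP => hA.exists_eval_eq_sum_iterDirDeriv hP⟩
  exact fun k l hkl P hP T hT =>
    hA.herm_summand_eq_zero (by omega) (by omega) (Fin.val_ne_of_ne hkl) hP hT
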